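/- Let $N,T\ge 1$ and $d\ge 1$ be integers, let $P_Z$ be a probability distribution on a measurable space $\mathcal Z$, and let $\ell:\mathbb R^d\times\mathcal Z\to[a,b]$ be a jointly measurable loss function such that $\theta\mapsto\ell(\theta,z)$ is differentiable for every $z$. Let $\tilde S=(\tilde Z_1,\dots,\tilde Z_{2N})$ be i.i.d. from $P_Z$, let $U=(U_1,\dots,U_N)$ be i.i.d. uniform on $\{0,1\}$, let $J$ be uniform on $\{1,\dots,N\}$, let $V^T=(V_1,\dots,V_T)$ be a random sequence (with an arbitrary joint law) of nonempty subsets of $\{1,\dots,N\}$ (the batches), let $W_0=\theta_0\in\mathbb R^d$ be a random initialization with an arbitrary law, and let $\varepsilon_1,\dots,\varepsilon_T$ be i.i.d. $\mathcal N(0,I_d)$; assume that $\tilde S$, $U$, $J$, $V^T$, $\theta_0$ and $(\varepsilon_1,\dots,\varepsilon_T)$ are mutually independent. The dataset is $S=(Z_1,\dots,Z_N)$ with $Z_i=\tilde Z_{i+U_iN}$. For deterministic $\eta_t\in\mathbb R$ and $\sigma_t>0$, stochastic gradient Langevin dynamics (SGLD) computes, for $t=1,\dots,T$, $$W_t=W_{t-1}-\eta_t\,\nabla_\theta\Big(\frac1{|V_t|}\sum_{i\in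 V_t}\ell(\theta,Z_i)\Big)\Big|_{\theta=W_{t-1}}+\sigma_t\varepsilon_t ,$$ and outputs $W=W_T$; write $W^{t-1}=(W_0,\dots,W_{t-1})$ and $V^{t-1}=(V_1,\dots,V_{t-1})$. The generalization error is $\mathrm{gen}(w,S)=\int\ell(w,z)\,dP_Z(z)-\frac1N\sum_{i=1}^N\ell(w,Z_i)$. For $j\in\{1,\dots,N\}$ and $t\in\{1,\dots,T\}$ let $\zeta_{j,t}=\nabla_\theta\ell(W_{t-1},\tilde Z_j)-\nabla_\theta\ell(W_{t-1},\tilde Z_{j+N})$, and let $\pi_{j,t}\in[0,1]$ be any measurable function of $W^{t-1}$, $\tilde S$, $(U_i)_{i\ne j}$ and $V^T$ (an estimate of the probability that $U_j=1$), chosen for every $j$ and $t$ separately. Put $\bar\pi_{j,t}=1-\pi_{j,t}$, let $\mathcal T_j(V^T)=\{t: j\in V_t\}$, and for $t\in\mathcal T_j(V^T)$ put $$f_{j,t}=\frac{\eta_t^2\|\zeta_{j,t}\|^2}{2\sigma_t^2|V_t|^2}\,(U_j-\pi_{j,t})^2,\qquad g_{j,t}=-\log\Big(|U_j-\pi_{j,t}|\,e^{-\frac{\eta_t^2\|\zeta_{j,t}\|^2}{2\sigma_t^2|V_t|^2}}+|\bar\pi_{j,t}-U_j|\Big).$$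 Then $\mathrm{gen}(W,S)$ is integrable and $$\mathbb E_{P_{W,S}}\big[\mathrm{gen}(W,S)\big]\le\sqrt2\,(b-a)\;\mathbb E_{P_1}\Bigg[\sqrt{\sum_{t\in\mathcal T_J(V^T)}\mathbb E_{P_2^t}\big[\min(f_{J,t},g_{J,t})\big]}\;\Bigg],$$ where $P_1=P_{J,\tilde S,U,V^T}$ is the joint law of $(J,\tilde S,U,V^T)$ and $P_2^t=P_{W^{t-1}\mid U,\tilde S,V^{t-1}}$ is the conditional law of $W^{t-1}$ given $(U,\tilde S,V^{t-1})$. The right-hand side may be $+\infty$, with $0\cdot\infty=0$. -/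

import Mathlib

open MeasureTheory ProbabilityTheory
open scoped ENNReal

noncomputable section

namespace SGLD

/-- The parameter space `ℝ^d`; a hypothesis is identified with its parameter. -/
abbrev Param (d : ℕ) : Type := EuclideanSpace ℝ (Fin d)

/-- A super-sample of `2N` points. The entry at `(i, u)` is the point number `i + u N`. -/
abbrev SuperSample (N : ℕ) (Z : Type*) : Type _ := Fin N × Fin 2 → Z

/-- The dataset `S = (Z_1, …, Z_N)` selected from the super-sample by the bits `u`. -/
def dataset {N : ℕ} {Z : Type*} (s : SuperSample N Z) (u : Fin N → Fin 2) : Fin N → Z :=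
  fun i => s (i, u i)

/-- The risk `L_{S_B}(w)` on the subset of the dataset `S` that is indexed by `B`. -/
def batchRisk {N d : ℕ} {Z : Type*} (loss : Param d → Z → ℝ) (S : Fin N → Z)
    (B : Finset (Fin N)) (w : Param d) : ℝ :=
  (1 / (B.card : ℝ)) * ∑ i ∈ B, loss w (S i)

/-- The empirical risk `L_S(w)`. -/
def empiricalRisk {N d : ℕ} {Z : Type*} (loss : Param d → Z → ℝ) (S : Fin N → Z)
    (w : Param d) : ℝ :=
  batchRisk loss S Finset.univ w

/-- The population risk `L_{P_Z}(w)`. -/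
def populationRisk {d : ℕ} {Z : Type*} [MeasurableSpace Z] (loss : Param d → Z → ℝ)
    (PZ : Measure Z) (w : Param d) : ℝ :=
  ∫ z, loss w z ∂PZ

/-- The generalization error `gen(w, S) = L_{P_Z}(w) - L_S(w)`. -/
def genError {N d : ℕ} {Z : Type*} [MeasurableSpace Z] (loss : Param d → Z → ℝ)
    (PZ : Measure Z) (w : Param d) (S : Fin N → Z) : ℝ :=
  populationRisk loss PZ w - empiricalRisk loss S w

/-- The SGLD iterates `θ_0, …, θ_T` on the dataset `S`, with step sizes `η`, noise levels `σ`,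
batches `v`, initialization `θ₀` and noise `ε`. The entry `t : Fin T` of `η`, `σ`, `v`, `ε` is used
in the update from the iterate number `t` to the iterate number `t + 1`. -/
def iterates {N d T : ℕ} {Z : Type*} (loss : Param d → Z → ℝ) (η σ : Fin T → ℝ)
    (S : Fin N → Z) (v : Fin T → Finset (Fin N)) (θ₀ : Param d) (ε : Fin T → Param d) :
    Fin (T + 1) → Param d :=
  Fin.induction θ₀ fun t θ =>
    θ - η t • gradient (batchRisk loss S (v t)) θ + σ t • ε t

/-- A trajectory of the hypotheses up to the one that the update `t` starts from. -/
abbrev History (d T : ℕ) (t : Fin T) : Type := Set.Iic t.castSucc → Param d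

/-- The last hypothesis of such a trajectory, i.e. the one that the update `t` starts from. -/
def History.last {d T : ℕ} {t : Fin T} (h : History d T t) : Param d :=
  h ⟨t.castSucc, le_refl t.castSucc⟩

/-- The law of `(S̃, U, J, V, θ₀, ε)`: the six blocks are independent, the `2N` points of `S̃` are
i.i.d. from `PZ`, the bits of `U` are i.i.d. fair coins, the index `J` is uniform, the batches have
the joint law `PV`, the initialization has the law `P0`, and the noise vectors are i.i.d. standard
Gaussian. -/
def jointLaw {N d T : ℕ} {Z : Type*} [MeasurableSpace Z] (PZ : Measure Z)
    (PV : Measure (Fin T → Finset (Fin N))) (P0 : Measure (Param d)) :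
    Measure (SuperSample N Z × (Fin N → Fin 2) × Fin N × (Fin T → Finset (Fin N)) ×
      Param d × (Fin T → Param d)) :=
  (Measure.pi fun _ => PZ).prod <|
    (Measure.pi fun _ => uniformOn (Set.univ : Set (Fin 2))).prod <|
      (uniformOn (Set.univ : Set (Fin N))).prod <|
        PV.prod <| P0.prod <| Measure.pi fun _ => stdGaussian (Param d)

/-- The conditional law of the trajectory of the hypotheses that precedes the update `t`, given the
bits, the super-sample and the batches used before that update, at the values `u`, `s`, `v`. -/
def historyLaw {Ω Z : Type*} [MeasurableSpace Ω] [MeasurableSpace Z] {N d T : ℕ}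
    (P : Measure Ω) [IsProbabilityMeasure P] (W : Ω → Fin (T + 1) → Param d)
    (S' : Ω → SuperSample N Z) (U : Ω → Fin N → Fin 2) (V : Ω → Fin T → Finset (Fin N))
    (t : Fin T) (u : Fin N → Fin 2) (s : SuperSample N Z) (v : Fin T → Finset (Fin N)) :
    Measure (History d T t) :=
  condDistrib (fun ω => (fun r => W ω r : History d T t))
    (fun ω => (U ω, S' ω, fun r : Set.Iio t => V ω r)) P (u, s, fun r : Set.Iio t => v r)

/-- The two-sample incoherence `ζ` of the pair number `j` at the hypothesis `w`. -/
def incoherence {N d : ℕ} {Z : Type*} (loss : Param d → Z → ℝ) (s : SuperSample N Z)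
    (j : Fin N) (w : Param d) : Param d :=
  gradient (fun θ => loss θ (s (j, 0))) w - gradient (fun θ => loss θ (s (j, 1))) w

/-- The exponent `η² ‖ζ‖² / (2 σ² |V|²)`, where `n = |V|`. -/
def signal {d : ℕ} (η σ : ℝ) (n : ℕ) (ζ : Param d) : ℝ :=
  η ^ 2 * ‖ζ‖ ^ 2 / (2 * σ ^ 2 * (n : ℝ) ^ 2)

/-- The single-Gaussian term `f`, with signal `A`, bit `u` and estimate `p`. -/
def fTerm (A : ℝ) (u : Fin 2) (p : ℝ) : ℝ :=
  A * (((u : ℕ) : ℝ) - p) ^ 2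

/-- The mixture term `g`, with signal `A`, bit `u` and estimate `p`. -/
def gTerm (A : ℝ) (u : Fin 2) (p : ℝ) : ℝ :=
  -Real.log (|((u : ℕ) : ℝ) - p| * Real.exp (-A) + |(1 - p) - ((u : ℕ) : ℝ)|)

/-- An estimator, at the update `t` and for the index `j`, of the probability that the bit number
`j` is one: it sees the trajectory of the hypotheses, the super-sample, all bits but the one
number `j`, and the batches. -/
abbrev Estimator (N d T : ℕ) (Z : Type*) : Type _ :=
  (t : Fin T) → (j : Fin N) →
    History d T t × SuperSample N Z × ({i : Fin N // i ≠ j} → Fin 2) × (Fin T → Finset (Fin N)) → ℝ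

/-- `min (f_{j,t}, g_{j,t})` as a function of the data and of the trajectory `h`. -/
def minTerm {N d T : ℕ} {Z : Type*} (loss : Param d → Z → ℝ) (η σ : Fin T → ℝ)
    (est : Estimator N d T Z) (t : Fin T) (j : Fin N) (s : SuperSample N Z) (u : Fin N → Fin 2)
    (v : Fin T → Finset (Fin N)) (h : History d T t) : ℝ :=
  min
    (fTerm (signal (η t) (σ t) (v t).card (incoherence loss s j h.last)) (u j)
      (est t j (h, s, fun i => u i, v)))
    (gTerm (signal (η t) (σ t) (v t).card (incoherence loss s j h.last)) (u j)
      (est t j (h, s, fun i => u i, v)))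

end SGLD

end

/-!
In expectation, `gen` is the mean over `j` of the gap between the losses on the two points of the
pair `j`: the unused point is independent of the output, so its mean loss is the population risk.
Fix all the data except the bit `U_j`, let `P_u` be the law of the trajectory when `U_j = u`, and
let `K_u` be the `P_u`-mean of the sum of `min (f, g)` over the updates that use the pair. It is
then enough to show that `P_0 φ - P_1 φ ≤ √(K_0 / 2) + √(K_1 / 2)` for `φ` with values in
`[0, 1]`.

Linearising the square roots with `l_u > 0` turns this into a bound on the two exponential values
`exp (l_0 P_0 φ - K_0)` and `exp (-l_1 P_1 φ - K_1)`; by symmetry one may assume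
`l_0 ≤ log (21 / 2)`, as the right-hand side exceeds `1` when both `l_u` are larger. A backward
recursion over the updates keeps this pair below some point of the curve
`s ↦ (1 + κ₀ s, 1 - κ₁ s)`, `s ∈ [0, 1]`, on which it ends by convexity. One update shifts a
Gaussian vector in a direction that depends on the bit. Where both bit values attain the minimum
at `f`, both values are compared with the law whose mean is shifted in proportion to the estimate
`π`; where both attain it at `g`, they are compared with the mixture of the two laws of weight
`π`. Where one attains it at `f` and the other at `g`, the signal is at least `5/4`; signals
above `4` are elementary, and for the others suitable shifts are read off a finite grid.
-/

open Real (exp exp_pos log)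

/-! ### Numerical inequalities for an update at which the two bit values attain different terms -/

namespace SGLD

/-- The slack left by the factors `E` and `w` of an update in the comparison of the two bit values;
`21 / 2 = 1 + 19 / 2` is the cut-off of the exponential cost. -/
noncomputable def slack (E w : ℝ) : ℝ := (23 - 21 * E - 2 * w) / 19

/-- The condition on the factors `E`, `w` and on the divergence `B` of the two compared Gaussian
laws under which a mixed update is possible. Both its sides are monotone, so that it can be checked
at upper bounds of `E`, `w` and `B`. -/
structure SlackSuffices (E w B : ℝ) : Prop where
  le_one : w ≤ 1
  slack_nonneg : 0 ≤ slack E w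
  le_slack_add : w ≤ slack E w + E
  min_le : min (w ^ 2 * (exp (2 * B) - 1)) (4 * E * w * (1 - exp (-(B / 2)))) ≤
    4 * slack E w * (slack E w + E - w)

theorem SlackSuffices.anti {E E' w w' B B' : ℝ} (h : SlackSuffices E' w' B') (hE : 0 ≤ E)
    (hEE' : E ≤ E') (hw : 0 ≤ w) (hww' : w ≤ w') (hB : 0 ≤ B) (hBB' : B ≤ B') :
    SlackSuffices E w B := by
  have hslack : slack E' w' ≤ slack E w := by unfold slack; linarith
  have hgap : slack E' w' + E' - w' ≤ slack E w + E - w := by unfold slack; linarith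
  have hgap' : 0 ≤ slack E' w' + E' - w' := by linarith [h.le_slack_add]
  have hmoment : 0 ≤ exp (2 * B) - 1 := by linarith [Real.one_le_exp (show 0 ≤ 2 * B by positivity)]
  have hhellinger : 0 ≤ 1 - exp (-(B / 2)) := by
    linarith [Real.exp_le_one_iff.2 (show -(B / 2) ≤ 0 by linarith)]
  have hE' := hE.trans hEE'
  have hw' := hw.trans hww'
  refine ⟨hww'.trans h.le_one, h.slack_nonneg.trans hslack, by linarith, ?_⟩
  calc _ ≤ _ := min_le_min (by gcongr) (by gcongr)
    _ ≤ _ := h.min_le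
    _ ≤ _ := mul_le_mul (by linarith) hgap hgap' (by linarith [h.slack_nonneg])

/-- The number of steps of the integer grid in a unit interval. -/
def gridUnit : ℕ := 4096

/-- The scale at which values of the exponential function are rounded to integers. -/
def expUnit : ℕ := 2 ^ 24

/-- An upper bound of `expUnit * exp (x / gridUnit ^ 3)`, for `x < 128 * gridUnit ^ 3`. -/
def expUpper (x : ℕ) : ℕ :=
  expUnit * (128 * gridUnit ^ 3) ^ 128 / (128 * gridUnit ^ 3 - x) ^ 128 + 1

/-- An upper bound of `expUnit * exp (-x / gridUnit ^ 3)`. -/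
def expNegUpper (x : ℕ) : ℕ :=
  expUnit * (128 * gridUnit ^ 3) ^ 128 / (128 * gridUnit ^ 3 + x) ^ 128 + 1

theorem gridUnit_pos : 0 < gridUnit := by decide

theorem expUnit_pos : 0 < expUnit := by decide

theorem mul_exp_le_div_add_one {S c d n : ℕ} {y : ℝ} (hn : 0 < n) (hd : 0 < d)
    (h : (d : ℝ) ≤ c * (1 - y / n)) : S * exp y ≤ (S * c ^ n / d ^ n + 1 : ℕ) := by
  have hd' : (0 : ℝ) < d := by exact_mod_cast hd
  have hround : (S : ℝ) * c ^ n ≤ (S * c ^ n / d ^ n + 1 : ℕ) * (d : ℝ) ^ n := by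
    exact_mod_cast (Nat.lt_div_mul_add (pow_pos hd n)).le.trans_eq (by ring)
  have hyn : y ≤ n := by
    have := pos_of_mul_pos_right (hd'.trans_le h) (by positivity)
    rw [sub_pos, div_lt_one (by positivity)] at this
    exact this.le
  have hexp : (d : ℝ) ^ n * exp y ≤ c ^ n := calc
    (d : ℝ) ^ n * exp y ≤ (c * (1 - y / n)) ^ n * exp y := by gcongr
    _ = c ^ n * ((1 - y / n) ^ n * exp y) := by rw [mul_pow, mul_assoc]
    _ ≤ c ^ n * (exp (-y) * exp y) := by
      gcongr
      exact Real.one_sub_div_pow_le_exp_neg hyn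
    _ = c ^ n := by rw [← Real.exp_add, neg_add_cancel, Real.exp_zero, mul_one]
  refine le_of_mul_le_mul_right (le_trans ?_ hround) (pow_pos hd' n)
  calc S * exp y * (d : ℝ) ^ n = S * ((d : ℝ) ^ n * exp y) := by ring
    _ ≤ S * (c : ℝ) ^ n := by gcongr

theorem mul_exp_le_expUpper {x : ℕ} {y : ℝ} (hx : x < 128 * gridUnit ^ 3)
    (hy : gridUnit ^ 3 * y ≤ x) : expUnit * exp y ≤ expUpper x := by
  refine mul_exp_le_div_add_one (by norm_num) (Nat.sub_pos_of_lt hx) ?_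
  rw [Nat.cast_sub hx.le]
  push_cast
  linarith

theorem mul_exp_neg_le_expNegUpper {x : ℕ} {y : ℝ} (hy : x ≤ gridUnit ^ 3 * y) :
    expUnit * exp (-y) ≤ expNegUpper x := by
  refine mul_exp_le_div_add_one (by norm_num) (by have := gridUnit_pos; positivity) ?_
  push_cast
  linarith

theorem mul_exp_sub_one_le {x y B : ℕ} (hB : 2 * B < 128 * gridUnit ^ 3)
    (h : x * expUpper (2 * B) ≤ (x + y) * expUnit) :
    (x : ℝ) * (exp (2 * (B / gridUnit ^ 3)) - 1) ≤ y := by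
  have hN : (0 : ℝ) < gridUnit := by exact_mod_cast gridUnit_pos
  have hS : (0 : ℝ) < expUnit := by exact_mod_cast expUnit_pos
  have hexp := mul_exp_le_expUpper hB (y := 2 * (B / gridUnit ^ 3)) (by push_cast; field_simp; rfl)
  have h' : (x : ℝ) * expUpper (2 * B) ≤ (x + y) * expUnit := by exact_mod_cast h
  refine le_of_mul_le_mul_right ?_ hS
  linarith [mul_le_mul_of_nonneg_left hexp x.cast_nonneg]

theorem mul_one_sub_exp_neg_le {x y B : ℕ} (hB : 2 * B < 128 * gridUnit ^ 3)
    (h : x * expUpper ((B + 1) / 2) ≤ x * expUnit + y * expUpper ((B + 1) / 2)) :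
    (x : ℝ) * (1 - exp (-(B / gridUnit ^ 3 / 2))) ≤ y := by
  have hN : (0 : ℝ) < gridUnit := by exact_mod_cast gridUnit_pos
  have hS : (0 : ℝ) < expUnit := by exact_mod_cast expUnit_pos
  have hexp := mul_exp_le_expUpper (x := (B + 1) / 2) (y := B / gridUnit ^ 3 / 2) (by omega) (by
    have : (B : ℝ) ≤ 2 * ((B + 1) / 2 : ℕ) := by exact_mod_cast (by omega : B ≤ 2 * ((B + 1) / 2))
    field_simp
    linarith)
  generalize expUpper ((B + 1) / 2) = e at h hexp
  have he : (0 : ℝ) < e := (by positivity : 0 < expUnit * exp _).trans_le hexp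
  have h' : (x : ℝ) * e ≤ x * expUnit + y * e := by exact_mod_cast h
  have hneg : expUnit / e ≤ exp (-(B / gridUnit ^ 3 / 2 : ℝ)) := by
    rw [Real.exp_neg, ← one_div, div_le_div_iff₀ he (exp_pos _), one_mul]
    exact hexp
  calc (x : ℝ) * (1 - exp (-(B / gridUnit ^ 3 / 2))) ≤ x * (1 - expUnit / e) := by gcongr
    _ ≤ y := by
      rw [one_sub_div he.ne', ← mul_div_assoc, div_le_iff₀ he]
      linarith

/-- A sufficient condition for `SlackSuffices` at `E / expUnit`, `w / (gridUnit * expUnit)` and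
`B / gridUnit ^ 3`, in integer arithmetic. -/
def checkSlack (E w B : ℕ) : Bool :=
  let h := 23 * gridUnit * expUnit - (21 * gridUnit * E + 2 * w)
  let m := h + 19 * gridUnit * E - 19 * w
  let e := expUpper ((B + 1) / 2)
  decide (w ≤ gridUnit * expUnit ∧ 2 * B < 128 * gridUnit ^ 3 ∧
    21 * gridUnit * E + 2 * w ≤ 23 * gridUnit * expUnit ∧ 19 * w ≤ h + 19 * gridUnit * E ∧
    (361 * w ^ 2 * expUpper (2 * B) ≤ (361 * w ^ 2 + 4 * h * m) * expUnit ∨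
      361 * gridUnit * E * w * e ≤ 361 * gridUnit * E * w * expUnit + h * m * e))

theorem slackSuffices_of_checkSlack {E w B : ℕ} (h : checkSlack E w B) :
    SlackSuffices (E / expUnit) (w / (gridUnit * expUnit)) (B / gridUnit ^ 3) := by
  obtain ⟨hw, hB, hh, hm, htest⟩ := of_decide_eq_true h
  have hN : (0 : ℝ) < gridUnit := by exact_mod_cast gridUnit_pos
  have hS : (0 : ℝ) < expUnit := by exact_mod_cast expUnit_pos
  set slk := 23 * gridUnit * expUnit - (21 * gridUnit * E + 2 * w) with hslk
  set gap := slk + 19 * gridUnit * E - 19 * w with hgap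
  have hslack : slack (E / expUnit) (w / (gridUnit * expUnit)) =
      slk / (19 * (gridUnit * expUnit)) := by
    rw [slack, hslk, Nat.cast_sub hh]; push_cast; field_simp; ring
  have hslack_add : slack (E / expUnit) (w / (gridUnit * expUnit)) + E / expUnit -
      w / (gridUnit * expUnit) = gap / (19 * (gridUnit * expUnit)) := by
    rw [hslack, hgap, Nat.cast_sub hm]; push_cast; field_simp
  refine ⟨?_, by rw [hslack]; positivity, by rw [← sub_nonneg, hslack_add]; positivity, ?_⟩
  · rw [div_le_one (by positivity)]; exact_mod_cast hw
  rw [hslack_add, hslack]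
  have hscale : (0 : ℝ) < 361 * (gridUnit * expUnit) ^ 2 := by positivity
  rcases htest with htest | htest
  · refine min_le_of_left_le (le_of_mul_le_mul_right ((Eq.trans_le ?_
      (mul_exp_sub_one_le hB htest)).trans_eq ?_) hscale)
    · push_cast; field_simp
    · push_cast; field_simp; norm_num
  · refine min_le_of_right_le (le_of_mul_le_mul_right (Eq.trans_le ?_ ((mul_le_mul_of_nonneg_left
      (mul_one_sub_exp_neg_le hB htest) zero_le_four).trans_eq ?_)) hscale)
    · push_cast; field_simp
    · push_cast; field_simp; norm_num

/-- The factor by which the cost `A * p ^ 2` of a shift exceeds the cost `A * π ^ 2`. -/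
noncomputable def shiftFactor (A π p : ℝ) : ℝ := exp (-(A * (π ^ 2 - p ^ 2)))

/-- The mixture `π + (1 - π) * exp (-A)`, relative to the cost `A * (1 - q) ^ 2` of a shift. -/
noncomputable def mixtureFactor (A π q : ℝ) : ℝ :=
  π * exp (A * (1 - q) ^ 2) + (1 - π) * exp (-(A * (1 - (1 - q) ^ 2)))

/-- A rectangle of parameters `(A, π)`, with corners on the integer grid. -/
structure Cell where
  aLo : ℕ
  aHi : ℕ
  piLo : ℕ
  piHi : ℕ

namespace Cell

/-- The points of a cell. -/
structure Contains (c : Cell) (A π : ℝ) : Prop where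
  aLo_le : c.aLo ≤ gridUnit * A
  le_aHi : gridUnit * A ≤ c.aHi
  piLo_le : c.piLo ≤ gridUnit * π
  le_piHi : gridUnit * π ≤ c.piHi

/-- Checks that the shifts `p / gridUnit` and `q / gridUnit` permit a mixed update at all points
of a cell. -/
def checkShifts (c : Cell) (p q : ℕ) : Bool :=
  decide (c.aHi ≤ 4 * gridUnit ∧ c.piHi ≤ gridUnit ∧ p ≤ c.piLo ∧ p ≤ q ∧ q ≤ gridUnit) &&
  checkSlack (expNegUpper (c.aLo * (c.piLo ^ 2 - p ^ 2)))
    (c.piHi * expUpper (c.aHi * (gridUnit - q) ^ 2) +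
      (gridUnit - c.piHi) * expNegUpper (c.aLo * (gridUnit ^ 2 - (gridUnit - q) ^ 2)))
    (c.aHi * (q - p) ^ 2)

/-- The four quarters of a cell. -/
def quarters (c : Cell) : List Cell :=
  let a := (c.aLo + c.aHi) / 2
  let π := (c.piLo + c.piHi) / 2
  [⟨c.aLo, a, c.piLo, π⟩, ⟨c.aLo, a, π, c.piHi⟩, ⟨a, c.aHi, c.piLo, π⟩, ⟨a, c.aHi, π, c.piHi⟩]

/-- Checks a cell by at most `n` subdivisions. The two pairs of shifts are tuned to the two bounds
in `SlackSuffices.min_le`. -/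
def check : ℕ → Cell → Bool
  | 0, _ => false
  | n + 1, c =>
    c.checkShifts (13 * c.piLo / 16) (3 * gridUnit / 16 + c.aLo / 8 + c.piLo / 4) ||
      c.checkShifts (c.piLo / 4) (13 * gridUnit / 16) || c.quarters.all (check n)

theorem Contains.exists_quarter {c : Cell} {A π : ℝ} (h : c.Contains A π) :
    ∃ c' ∈ c.quarters, c'.Contains A π := by
  obtain ⟨h₁, h₂, h₃, h₄⟩ := h
  rcases le_total (gridUnit * A) ((c.aLo + c.aHi) / 2 : ℕ) with ha | ha <;>
    rcases le_total (gridUnit * π) ((c.piLo + c.piHi) / 2 : ℕ) with hp | hp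
  · exact ⟨_, .head _, h₁, ha, h₃, hp⟩
  · exact ⟨_, .tail _ (.head _), h₁, ha, hp, h₄⟩
  · exact ⟨_, .tail _ (.tail _ (.head _)), ha, h₂, h₃, hp⟩
  · exact ⟨_, .tail _ (.tail _ (.tail _ (.head _))), ha, h₂, hp, h₄⟩

theorem Contains.nonneg {c : Cell} {A π : ℝ} (hc : c.Contains A π) : 0 ≤ A ∧ 0 ≤ π :=
  have hN : (0 : ℝ) < gridUnit := by exact_mod_cast gridUnit_pos
  ⟨nonneg_of_mul_nonneg_right ((Nat.cast_nonneg _).trans hc.aLo_le) hN,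
    nonneg_of_mul_nonneg_right ((Nat.cast_nonneg _).trans hc.piLo_le) hN⟩

theorem Contains.shiftFactor_le {c : Cell} {A π : ℝ} (hc : c.Contains A π) {p : ℕ}
    (hp : p ≤ c.piLo) :
    shiftFactor A π (p / gridUnit) ≤ expNegUpper (c.aLo * (c.piLo ^ 2 - p ^ 2)) / expUnit := by
  obtain ⟨hA, -⟩ := hc.nonneg
  obtain ⟨ha, -, hpi, -⟩ := hc
  have hN : (0 : ℝ) < gridUnit := by exact_mod_cast gridUnit_pos
  rw [le_div_iff₀' (by exact_mod_cast expUnit_pos)]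
  refine mul_exp_neg_le_expNegUpper ?_
  push_cast [Nat.cast_sub (Nat.pow_le_pow_left hp 2)]
  calc (c.aLo : ℝ) * (c.piLo ^ 2 - p ^ 2) ≤ gridUnit * A * ((gridUnit * π) ^ 2 - p ^ 2) := by
        gcongr
        rw [sub_nonneg]
        gcongr
    _ = _ := by field_simp

theorem Contains.mixtureFactor_le {c : Cell} {A π : ℝ} (hc : c.Contains A π) {q : ℕ}
    (ha : c.aHi ≤ 4 * gridUnit) (hpi : c.piHi ≤ gridUnit) (hq : q ≤ gridUnit) :
    mixtureFactor A π (q / gridUnit) ≤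
      (c.piHi * expUpper (c.aHi * (gridUnit - q) ^ 2) + (gridUnit - c.piHi : ℕ) *
        expNegUpper (c.aLo * (gridUnit ^ 2 - (gridUnit - q) ^ 2)) : ℕ) / (gridUnit * expUnit) := by
  obtain ⟨hA, -⟩ := hc.nonneg
  obtain ⟨haLo, haHi, -, hpiHi⟩ := hc
  have hN : (0 : ℝ) < gridUnit := by exact_mod_cast gridUnit_pos
  have hS : (0 : ℝ) < expUnit := by exact_mod_cast expUnit_pos
  have hr : (gridUnit - q) ^ 2 ≤ gridUnit ^ 2 := Nat.pow_le_pow_left (Nat.sub_le _ _) 2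
  have hexp : expUnit * exp (A * (1 - q / gridUnit) ^ 2) ≤
      expUpper (c.aHi * (gridUnit - q) ^ 2) := by
    refine mul_exp_le_expUpper ?_ ?_
    · calc c.aHi * (gridUnit - q) ^ 2 ≤ 4 * gridUnit * gridUnit ^ 2 := Nat.mul_le_mul ha hr
        _ < 128 * gridUnit ^ 3 := by decide
    push_cast [Nat.cast_sub hq]
    calc _ = gridUnit * A * (gridUnit - q : ℝ) ^ 2 := by field_simp
      _ ≤ _ := by gcongr
  have hexpNeg : expUnit * exp (-(A * (1 - (1 - q / gridUnit) ^ 2))) ≤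
      expNegUpper (c.aLo * (gridUnit ^ 2 - (gridUnit - q) ^ 2)) := by
    refine mul_exp_neg_le_expNegUpper ?_
    calc ((c.aLo * (gridUnit ^ 2 - (gridUnit - q) ^ 2) : ℕ) : ℝ)
        ≤ gridUnit * A * ((gridUnit ^ 2 - (gridUnit - q) ^ 2 : ℕ) : ℝ) := by push_cast; gcongr
      _ = _ := by push_cast [Nat.cast_sub hq, Nat.cast_sub hr]; field_simp
  have hle : exp (-(A * (1 - (1 - q / gridUnit) ^ 2))) ≤ exp (A * (1 - q / gridUnit) ^ 2) :=
    Real.exp_le_exp.2 (by linarith)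
  have hπ : π ≤ c.piHi / gridUnit := by rwa [le_div_iff₀' hN]
  have : (c.piHi : ℝ) / gridUnit ≤ 1 := by
    rw [div_le_one hN]; exact_mod_cast hpi
  unfold mixtureFactor
  generalize exp (A * (1 - q / gridUnit) ^ 2) = u at hexp hle ⊢
  generalize exp (-(A * (1 - (1 - q / gridUnit) ^ 2))) = v at hexpNeg hle ⊢
  calc π * u + (1 - π) * v ≤ c.piHi / gridUnit * u + (1 - c.piHi / gridUnit) * v := by
        linarith [mul_le_mul_of_nonneg_right hπ (sub_nonneg.2 hle)]
    _ = (c.piHi * (expUnit * u) + (gridUnit - c.piHi) * (expUnit * v)) / (gridUnit * expUnit) := by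
        field_simp
    _ ≤ _ := by
        push_cast [Nat.cast_sub hpi]
        have : (0 : ℝ) ≤ gridUnit - c.piHi := sub_nonneg.2 (by exact_mod_cast hpi)
        gcongr

theorem exists_slackSuffices_of_checkShifts {c : Cell} {A π : ℝ} {p q : ℕ} (hc : c.Contains A π)
    (h : c.checkShifts p q) :
    ∃ p q, 0 ≤ p ∧ p ≤ π ∧
      SlackSuffices (shiftFactor A π p) (mixtureFactor A π q) (A * (q - p) ^ 2) := by
  rw [checkShifts, Bool.and_eq_true, decide_eq_true_iff] at h
  obtain ⟨⟨haHi, hpiHi, hp, hpq, hq⟩, h⟩ := h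
  obtain ⟨hA, hπ⟩ := hc.nonneg
  have hN : (0 : ℝ) < gridUnit := by exact_mod_cast gridUnit_pos
  have hpπ : (p / gridUnit : ℝ) ≤ π := by
    rw [div_le_iff₀' hN]
    exact le_trans (by exact_mod_cast hp) hc.piLo_le
  have hπ1 : 0 ≤ 1 - π :=
    sub_nonneg.2 (le_of_mul_le_mul_left (hc.le_piHi.trans (by simpa using hpiHi)) hN)
  refine ⟨p / gridUnit, q / gridUnit, by positivity, hpπ, (slackSuffices_of_checkSlack h).anti
    (exp_pos _).le (hc.shiftFactor_le hp) ?_ (hc.mixtureFactor_le haHi hpiHi hq) (by positivity) ?_⟩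
  · unfold mixtureFactor
    positivity
  · rw [le_div_iff₀' (by positivity)]
    push_cast [Nat.cast_sub hpq]
    calc _ = gridUnit * A * (q - p : ℝ) ^ 2 := by field_simp
      _ ≤ _ := mul_le_mul_of_nonneg_right hc.le_aHi (sq_nonneg _)

theorem exists_slackSuffices_of_check {n : ℕ} {c : Cell} {A π : ℝ} (hc : c.Contains A π)
    (h : check n c) :
    ∃ p q, 0 ≤ p ∧ p ≤ π ∧
      SlackSuffices (shiftFactor A π p) (mixtureFactor A π q) (A * (q - p) ^ 2) := by
  induction n generalizing c with
  | zero => simp [check] at h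
  | succ n ih =>
    simp only [check, Bool.or_eq_true, List.all_eq_true] at h
    rcases h with (h | h) | h
    · exact exists_slackSuffices_of_checkShifts hc h
    · exact exists_slackSuffices_of_checkShifts hc h
    · obtain ⟨c', hc', hcontains⟩ := hc.exists_quarter
      exact ih hcontains (h c' hc')

set_option maxRecDepth 100000 in
theorem check_rectangle :
    check 9 ⟨5 * gridUnit / 4, 4 * gridUnit, 0, gridUnit / 2⟩ = true := by
  decide +kernel

end Cell

theorem exists_slackSuffices {A π : ℝ} (hA : A ∈ Set.Icc (5 / 4) 4) (hπ : π ∈ Set.Icc 0 (1 / 2)) :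
    ∃ p q, 0 ≤ p ∧ p ≤ π ∧ SlackSuffices (shiftFactor A π p) (mixtureFactor A π q)
      (A * (q - p) ^ 2) := by
  refine Cell.exists_slackSuffices_of_check ⟨?_, ?_, ?_, ?_⟩ Cell.check_rectangle <;>
    norm_num [gridUnit] <;> linarith [hA.1, hA.2, hπ.1, hπ.2]

theorem convexOn_neg_log_one_sub_mul_div_sq {x : ℝ} (hx : 0 < x) :
    ConvexOn ℝ (Set.Ioo 0 x⁻¹) (fun r => -log (1 - x * r) / r ^ 2) := by
  have hseries : ∀ r ∈ Set.Ioo 0 x⁻¹,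
      HasSum (fun n : ℕ => x ^ (n + 1) / (n + 1) * r ^ ((n : ℤ) - 1))
        (-log (1 - x * r) / r ^ 2) := by
    intro r hr
    have hxr : |x * r| < 1 := by
      rw [abs_of_pos (mul_pos hx hr.1)]
      exact (mul_lt_mul_of_pos_left hr.2 hx).trans_eq (mul_inv_cancel₀ hx.ne')
    refine ((Real.hasSum_pow_div_log_of_abs_lt_one hxr).div_const (r ^ 2)).congr_fun fun n => ?_
    have hr0 : r ≠ 0 := hr.1.ne'
    rw [zpow_sub₀ hr0, zpow_natCast, zpow_one, mul_pow]
    field_simp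
    exact (pow_succ r n).symm
  refine ⟨convex_Ioo _ _, fun r hr s hs a b ha hb hab => ?_⟩
  refine hasSum_le (fun n => ?_) (hseries _ (convex_Ioo _ _ hr hs ha hb hab))
    (((hseries r hr).mul_left a).add ((hseries s hs).mul_left b))
  have := mul_le_mul_of_nonneg_left ((convexOn_zpow (𝕜 := ℝ) ((n : ℤ) - 1)).2 hr.1 hs.1 ha hb hab)
    (show 0 ≤ x ^ (n + 1) / (n + 1) by positivity)
  simp only [smul_eq_mul] at this ⊢
  linarith

theorem exp_neg_mul_sq_le_one_sub_mul_iff {A x r : ℝ} (hr : 0 < r) (hxr : 0 < 1 - x * r) :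
    exp (-(A * r ^ 2)) ≤ 1 - x * r ↔ -log (1 - x * r) / r ^ 2 ≤ A := by
  rw [← Real.le_log_iff_exp_le hxr, div_le_iff₀ (by positivity), neg_le]

theorem exp_neg_mul_sq_le_mixture_of_lt {A p r : ℝ} (hA : 0 ≤ A) (hp : 0 ≤ p) (hpr : p ≤ r)
    (hr : r ≤ 1) (h : exp (-(A * p ^ 2)) < 1 - p * (1 - exp (-A))) :
    exp (-(A * r ^ 2)) ≤ 1 - r * (1 - exp (-A)) := by
  have hA : 0 < A := hA.lt_of_ne (by rintro rfl; simp at h)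
  have hp : 0 < p := hp.lt_of_ne (by rintro rfl; simp at h)
  replace h := h.le
  set x := 1 - exp (-A) with hx
  have hx0 : 0 < x := sub_pos.2 (Real.exp_lt_one_iff.2 (neg_neg_of_pos hA))
  have hx1 : x < 1 := sub_lt_self _ (exp_pos _)
  have hmem : ∀ s, 0 < s → s ≤ 1 → s ∈ Set.Ioo 0 x⁻¹ := fun s h0 h1 =>
    ⟨h0, h1.trans_lt ((one_lt_inv₀ hx0).2 hx1)⟩
  have hpos : ∀ s ≤ 1, 0 < 1 - x * s := fun s h1 => by
    linarith [mul_le_mul_of_nonneg_left h1 hx0.le]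
  rw [mul_comm p x, exp_neg_mul_sq_le_one_sub_mul_iff hp (hpos p (hpr.trans hr))] at h
  rw [mul_comm r x, exp_neg_mul_sq_le_one_sub_mul_iff (hp.trans_le hpr) (hpos r hr)]
  refine ((convexOn_neg_log_one_sub_mul_div_sq hx0).le_max_of_mem_Icc (hmem p hp (hpr.trans hr))
    (hmem 1 one_pos le_rfl) ⟨hpr, hr⟩).trans (max_le h ?_)
  simp [hx]

theorem exp_le_one_add_two_mul {z : ℝ} (hz : 0 ≤ z) (h : z ≤ 5 / 4) : exp z ≤ 1 + 2 * z := by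
  have hexp : exp (5 / 4) ≤ 7 / 2 := by
    refine le_of_pow_le_pow_left₀ four_ne_zero (by norm_num) ?_
    calc exp (5 / 4) ^ 4 = exp 1 ^ 5 := by simp only [← Real.exp_nat_mul]; norm_num
      _ ≤ 2.7182818286 ^ 5 := by gcongr; exact Real.exp_one_lt_d9.le
      _ ≤ (7 / 2) ^ 4 := by norm_num
  have hconvex := convexOn_exp.2 (Set.mem_univ 0) (Set.mem_univ (5 / 4))
    (show 0 ≤ 1 - 4 / 5 * z by linarith) (show 0 ≤ 4 / 5 * z by positivity) (by ring)
  simp only [smul_eq_mul, mul_zero, zero_add, Real.exp_zero, mul_one] at hconvex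
  calc exp z = exp (4 / 5 * z * (5 / 4)) := by ring_nf
    _ ≤ 1 + 2 * z := by nlinarith

theorem hasDerivAt_neg_log_one_sub_mul_div_sq (A : ℝ) :
    HasDerivAt (fun r => -log (1 - (1 - exp (-A)) * r) / r ^ 2) (exp A - 1 - 2 * A) 1 := by
  have hlog := ((((hasDerivAt_id (1 : ℝ)).const_mul (1 - exp (-A))).const_sub 1).log
    (by simp)).neg
  refine (hlog.div (hasDerivAt_pow 2 1) (by norm_num)).congr_deriv ?_
  simp [Real.exp_neg]
  field_simp
  ring

theorem mixture_le_exp_neg_mul_sq {A r : ℝ} (hA : 0 ≤ A) (hA' : A ≤ 5 / 4) (hr : 0 ≤ r)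
    (hr1 : r ≤ 1) : 1 - r * (1 - exp (-A)) ≤ exp (-(A * r ^ 2)) := by
  rcases hr.eq_or_lt with rfl | hr
  · simp
  rcases hr1.eq_or_lt with rfl | hr1
  · simp
  rcases hA.eq_or_lt with rfl | hA
  · simp
  set x := 1 - exp (-A) with hx
  have hx0 : 0 < x := sub_pos.2 (Real.exp_lt_one_iff.2 (neg_neg_of_pos hA))
  have hx1 : 1 < x⁻¹ := (one_lt_inv₀ hx0).2 (sub_lt_self _ (exp_pos _))
  have hxr : 0 < 1 - x * r := by nlinarith [exp_pos (-A)]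
  by_contra! hlt
  have hslope := (convexOn_neg_log_one_sub_mul_div_sq hx0).slope_le_of_hasDerivAt
    ⟨hr, hr1.trans hx1⟩ ⟨one_pos, hx1⟩ hr1
    (hasDerivAt_neg_log_one_sub_mul_div_sq A)
  have hval : -log (1 - x * r) / r ^ 2 < A := by
    rw [div_lt_iff₀ (by positivity), neg_lt, Real.lt_log_iff_exp_lt hxr, mul_comm x]
    exact hlt
  have hpos : 0 < slope (fun r => -log (1 - x * r) / r ^ 2) r 1 := by
    rw [slope_def_field]
    refine div_pos (sub_pos.2 ?_) (sub_pos.2 hr1)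
    simpa [hx] using hval
  linarith [exp_le_one_add_two_mul hA.le hA']

theorem exp_add_mixture_le_of_four_le {A π : ℝ} (hA : 4 ≤ A) (hπ : π ∈ Set.Icc 0 (1 / 2)) :
    exp (-(A * π ^ 2)) + (π + (1 - π) * exp (-A)) ≤ 23 / 21 := by
  obtain ⟨hπ0, hπ1⟩ := hπ
  have hexp : exp (-A) ≤ 1 / 50 :=
    calc exp (-A) ≤ exp (-4) := by gcongr
      _ = (exp 1 ^ 4)⁻¹ := by rw [← Real.exp_nat_mul, ← Real.exp_neg]; norm_num
      _ ≤ (2.7182818283 ^ 4)⁻¹ := by gcongr; exact Real.exp_one_gt_d9.le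
      _ ≤ 1 / 50 := by norm_num
  have hgauss : exp (-(A * π ^ 2)) ≤ 1 / (1 + 4 * π ^ 2 + 8 * π ^ 4) :=
    calc exp (-(A * π ^ 2)) ≤ exp (-(4 * π ^ 2)) := by gcongr
      _ = 1 / exp (4 * π ^ 2) := by rw [Real.exp_neg, one_div]
      _ ≤ _ := by
        gcongr
        linarith [Real.quadratic_le_exp_of_nonneg (x := 4 * π ^ 2) (by positivity)]
  have hrational : 1 / (1 + 4 * π ^ 2 + 8 * π ^ 4) ≤ 23 / 21 - π - (1 - π) * (1 / 50) := by
    have hπ' := sub_nonneg.2 hπ1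
    rw [div_le_iff₀ (by positivity)]
    nlinarith [sq_nonneg (π - 1 / 7), sq_nonneg (π * (π - 1 / 7)), mul_nonneg hπ0 hπ',
      mul_nonneg (pow_nonneg hπ0 2) hπ', mul_nonneg (pow_nonneg hπ0 3) hπ',
      mul_nonneg (pow_nonneg hπ0 4) hπ']
  linarith [mul_le_mul_of_nonneg_left hexp (show 0 ≤ 1 - π by linarith)]

/-! ### One update: trading off the costs of the two bit values -/

/-- The exponential of the negated `min (f, g)` of an update whose estimate `π` of the bit `u` has
error `r = |u - π|`. -/
noncomputable def updateFactor (A r : ℝ) : ℝ :=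
  max (exp (-(A * r ^ 2))) (1 - r * (1 - exp (-A)))

/-- The exponential costs `x₀`, `x₁` of the bit values `0`, `1` are dominated by a point of the
curve `s ↦ (1 + κ₀ s, 1 - κ₁ s)`, on which the two costs trade off against each other. -/
def Admissible (κ₀ κ₁ x₀ x₁ : ℝ) : Prop :=
  ∃ s ∈ Set.Icc (0 : ℝ) 1, x₀ ≤ 1 + κ₀ * s ∧ x₁ ≤ 1 - κ₁ * s

theorem Admissible.of_reflect {κ₀ κ₁ x₀ x₁ : ℝ} (hκ₀ : 0 < 1 + κ₀) (hκ₁ : 0 < 1 - κ₁)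
    (h : Admissible (κ₁ / (1 - κ₁)) (κ₀ / (1 + κ₀)) (x₁ / (1 - κ₁)) (x₀ / (1 + κ₀))) :
    Admissible κ₀ κ₁ x₀ x₁ := by
  obtain ⟨s, hs, hs₁, hs₀⟩ := h
  refine ⟨1 - s, ⟨by linarith [hs.2], by linarith [hs.1]⟩, ?_, ?_⟩
  · rw [div_le_iff₀ hκ₀] at hs₀
    refine hs₀.trans_eq ?_
    field_simp
    ring
  · rw [div_le_iff₀ hκ₁] at hs₁
    refine hs₁.trans_eq ?_
    field_simp
    ring

theorem admissible_of_sub_le {κ₀ κ₁ x₀ x₁ E w s₀ s₁ : ℝ} (hκ₀ : κ₀ ∈ Set.Ioc 0 (19 / 2))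
    (hκ₁ : κ₁ ∈ Set.Ioc 0 (19 / 21)) (hE : E ∈ Set.Icc 0 1) (hw : w ∈ Set.Icc 0 1)
    (hs₀ : s₀ ∈ Set.Icc 0 1) (hs₁ : 0 ≤ s₁) (hx₀ : x₀ ≤ E * (1 + κ₀ * s₀))
    (hx₁ : x₁ ≤ w * (1 - κ₁ * s₁)) (h : w * (1 - s₁) - E * (1 - s₀) ≤ slack E w) :
    Admissible κ₀ κ₁ x₀ x₁ := by
  have hE' : 0 ≤ 1 - E := sub_nonneg.2 hE.2
  have hw' : 0 ≤ 1 - w := sub_nonneg.2 hw.2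
  rcases le_total (E * (1 + κ₀ * s₀)) 1 with hle | hge
  · have : 0 ≤ w * (κ₁ * s₁) := mul_nonneg hw.1 (mul_nonneg hκ₁.1.le hs₁)
    exact ⟨0, by simp, by linarith, by linarith⟩
  set s := (E * (1 + κ₀ * s₀) - 1) / κ₀ with hs
  have hs_le : s ≤ E * s₀ - (1 - E) * (2 / 19) := by
    rw [hs, div_le_iff₀ hκ₀.1]
    linarith [mul_le_mul_of_nonneg_left hκ₀.2 hE']
  have hs_le' : s ≤ (1 - w) * (21 / 19) + w * s₁ := by
    unfold slack at h
    linarith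
  refine ⟨s, ⟨div_nonneg (sub_nonneg.2 hge) hκ₀.1.le, ?_⟩, ?_, ?_⟩
  · linarith [mul_le_one₀ hE.2 hs₀.1 hs₀.2]
  · rw [hs, mul_div_cancel₀ _ hκ₀.1.ne']
    linarith
  · linarith [mul_le_mul_of_nonneg_left hs_le' hκ₁.1.le, mul_le_mul_of_nonneg_right hκ₁.2 hw']

/-- A bound on the change of the mean `a` of a `[0, 1]`-valued function under the translation of a
Gaussian law from `p δ` to `q δ`, where `A = ‖δ‖² / 2`. It is stated for arbitrary weights `w` and
`E` of the two laws; the minimum is over the `χ²` and the Hellinger distance between them. -/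
def MeanShiftBound (A : ℝ) (a : ℝ → ℝ) : Prop :=
  ∀ p q E w : ℝ, 0 ≤ E → 0 ≤ w →
    (2 * (w * a q - E * a p) - (w - E)) ^ 2 ≤ (w - E) ^ 2 +
      min (w ^ 2 * (exp (2 * (A * (q - p) ^ 2)) - 1))
        (4 * E * w * (1 - exp (-(A * (q - p) ^ 2 / 2))))

theorem MeanShiftBound.one_sub {A : ℝ} {a : ℝ → ℝ} (h : MeanShiftBound A a) :
    MeanShiftBound A fun p => 1 - a p := fun p q E w hE hw => by
  convert h p q E w hE hw using 1
  ring

theorem MeanShiftBound.comp_one_sub {A : ℝ} {a : ℝ → ℝ} (h : MeanShiftBound A a) :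
    MeanShiftBound A fun p => a (1 - p) := fun p q E w hE hw => by
  have := h (1 - p) (1 - q) E w hE hw
  rwa [show (1 - q - (1 - p)) ^ 2 = (q - p) ^ 2 by ring] at this

theorem MeanShiftBound.sub_le_slack {A p q E w : ℝ} {a : ℝ → ℝ} (h : MeanShiftBound A a)
    (hE : 0 ≤ E) (hw : 0 ≤ w) (hslack : SlackSuffices E w (A * (q - p) ^ 2)) :
    w * a q - E * a p ≤ slack E w := by
  have hsq : (2 * (w * a q - E * a p) - (w - E)) ^ 2 ≤ (2 * slack E w + E - w) ^ 2 :=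
    calc _ ≤ _ := h p q E w hE hw
      _ ≤ (w - E) ^ 2 + 4 * slack E w * (slack E w + E - w) := by
        gcongr
        exact hslack.min_le
      _ = _ := by ring
  have := le_of_sq_le_sq hsq (by linarith [hslack.slack_nonneg, hslack.le_slack_add])
  linarith

/-- The data from which the exponential costs before an update are controlled: `a₀` and `a₁` bound
the exponential costs of the two bit values after it, and `α p` is the mean position on the curve
`s ↦ (1 + κ₀ s, 1 - κ₁ s)` when the drifts of the two bit values are mixed with weight `p`. -/
structure StepData (A κ₀ κ₁ a₀ a₁ : ℝ) (α : ℝ → ℝ) : Prop where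
  curve₀ : κ₀ ∈ Set.Ioc 0 (19 / 2)
  curve₁ : κ₁ ∈ Set.Ioc 0 (19 / 21)
  mean_mem (p : ℝ) : α p ∈ Set.Icc 0 1
  shift₀ (p : ℝ) : exp (-(A * p ^ 2)) * a₀ ≤ 1 + κ₀ * α p
  shift₁ (p : ℝ) : exp (-(A * (1 - p) ^ 2)) * a₁ ≤ 1 - κ₁ * α p
  meanShiftBound : MeanShiftBound A α

namespace StepData

variable {A π κ₀ κ₁ a₀ a₁ : ℝ} {α : ℝ → ℝ}

theorem le_top (h : StepData A κ₀ κ₁ a₀ a₁ α) : a₀ ≤ 1 + κ₀ := by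
  have := h.shift₀ 0
  norm_num at this
  linarith [mul_le_of_le_one_right h.curve₀.1.le (h.mean_mem 0).2]

theorem le_one (h : StepData A κ₀ κ₁ a₀ a₁ α) : a₁ ≤ 1 := by
  have := h.shift₁ 1
  norm_num at this
  linarith [mul_nonneg h.curve₁.1.le (h.mean_mem 1).1]

theorem reflect (h : StepData A κ₀ κ₁ a₀ a₁ α) :
    StepData A (κ₁ / (1 - κ₁)) (κ₀ / (1 + κ₀)) (a₁ / (1 - κ₁)) (a₀ / (1 + κ₀))
      fun p => 1 - α (1 - p) := by
  obtain ⟨⟨hκ₀, hκ₀'⟩, ⟨hκ₁, hκ₁'⟩, hα, h₀, h₁, hmean⟩ := h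
  have hpos₀ : 0 < 1 + κ₀ := by linarith
  have hpos₁ : 0 < 1 - κ₁ := by linarith
  refine ⟨⟨by positivity, ?_⟩, ⟨by positivity, ?_⟩,
    fun p => ⟨sub_nonneg.2 (hα _).2, sub_le_self _ (hα _).1⟩, fun p => ?_, fun p => ?_,
    hmean.comp_one_sub.one_sub⟩
  · rw [div_le_iff₀ hpos₁]
    linarith
  · rw [div_le_iff₀ hpos₀]
    linarith
  · have := h₁ (1 - p)
    rw [sub_sub_cancel] at this
    rw [← mul_div_assoc, div_le_iff₀ hpos₁]
    refine this.trans_eq ?_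
    field_simp
    ring
  · rw [← mul_div_assoc, div_le_iff₀ hpos₀]
    refine (h₀ (1 - p)).trans_eq ?_
    field_simp
    ring

theorem admissible_exp (h : StepData A κ₀ κ₁ a₀ a₁ α) :
    Admissible κ₀ κ₁ (exp (-(A * π ^ 2)) * a₀) (exp (-(A * (1 - π) ^ 2)) * a₁) :=
  ⟨α π, h.mean_mem π, h.shift₀ π, h.shift₁ π⟩

theorem admissible_mixture (h : StepData A κ₀ κ₁ a₀ a₁ α) (hπ : π ∈ Set.Icc 0 1) :
    Admissible κ₀ κ₁ ((1 - π * (1 - exp (-A))) * a₀) ((1 - (1 - π) * (1 - exp (-A))) * a₁) := by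
  have hπ' : 0 ≤ 1 - π := sub_nonneg.2 hπ.2
  have h₀₀ := mul_le_mul_of_nonneg_left (h.shift₀ 0) hπ'
  have h₀₁ := mul_le_mul_of_nonneg_left (h.shift₀ 1) hπ.1
  have h₁₀ := mul_le_mul_of_nonneg_left (h.shift₁ 0) hπ'
  have h₁₁ := mul_le_mul_of_nonneg_left (h.shift₁ 1) hπ.1
  norm_num at h₀₀ h₀₁ h₁₀ h₁₁
  refine ⟨(1 - π) * α 0 + π * α 1,
    convex_Icc 0 1 (h.mean_mem 0) (h.mean_mem 1) hπ' hπ.1 (by ring), ?_, ?_⟩ <;> linarith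

theorem admissible_exp_mixture_of_add_le (h : StepData A κ₀ κ₁ a₀ a₁ α) (hA : 0 ≤ A)
    (hπ : π ∈ Set.Icc 0 1)
    (hadd : exp (-(A * π ^ 2)) + (π + (1 - π) * exp (-A)) ≤ 23 / 21) :
    Admissible κ₀ κ₁ (exp (-(A * π ^ 2)) * a₀) ((1 - (1 - π) * (1 - exp (-A))) * a₁) := by
  have hexp : exp (-(A * π ^ 2)) ≤ 1 := Real.exp_le_one_iff.2 (neg_nonpos.2 (by positivity))
  have hmixture : 1 - (1 - π) * (1 - exp (-A)) ∈ Set.Icc (0 : ℝ) 1 := by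
    have := mul_le_one₀ (show 1 - exp (-A) ≤ 1 by linarith [exp_pos (-A)])
      (sub_nonneg.2 hπ.2) (show 1 - π ≤ 1 by linarith [hπ.1])
    have := mul_nonneg (sub_nonneg.2 hπ.2)
      (sub_nonneg.2 (Real.exp_le_one_iff.2 (neg_nonpos.2 hA)))
    constructor <;> linarith
  refine admissible_of_sub_le h.curve₀ h.curve₁ ⟨(exp_pos _).le, hexp⟩ hmixture
    (s₀ := 1) (s₁ := 0) (by simp) le_rfl ?_ ?_ ?_
  · rw [mul_one]
    exact mul_le_mul_of_nonneg_left h.le_top (exp_pos _).le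
  · rw [mul_zero, sub_zero]
    exact mul_le_mul_of_nonneg_left h.le_one hmixture.1
  · unfold slack
    linarith

theorem admissible_exp_mixture_of_slackSuffices {p q : ℝ} (h : StepData A κ₀ κ₁ a₀ a₁ α)
    (hA : 0 ≤ A) (hπ : π ∈ Set.Icc 0 1) (hp : 0 ≤ p) (hpπ : p ≤ π)
    (hslack : SlackSuffices (shiftFactor A π p) (mixtureFactor A π q) (A * (q - p) ^ 2)) :
    Admissible κ₀ κ₁ (exp (-(A * π ^ 2)) * a₀) ((1 - (1 - π) * (1 - exp (-A))) * a₁) := by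
  have hE : shiftFactor A π p ∈ Set.Icc (0 : ℝ) 1 :=
    ⟨(exp_pos _).le, Real.exp_le_one_iff.2 (neg_nonpos.2 (mul_nonneg hA
      (sub_nonneg.2 (pow_le_pow_left₀ hp hpπ 2))))⟩
  have hw : 0 ≤ mixtureFactor A π q := by
    have := sub_nonneg.2 hπ.2
    have := hπ.1
    unfold mixtureFactor
    positivity
  have hexp : exp (-(A * π ^ 2)) = shiftFactor A π p * exp (-(A * p ^ 2)) := by
    rw [shiftFactor, ← Real.exp_add]
    ring_nf
  have hmixture :
      1 - (1 - π) * (1 - exp (-A)) = mixtureFactor A π q * exp (-(A * (1 - q) ^ 2)) := by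
    rw [mixtureFactor, add_mul, mul_assoc, mul_assoc, ← Real.exp_add, ← Real.exp_add,
      add_neg_cancel, Real.exp_zero, ← neg_add, ← mul_add, sub_add_cancel, mul_one, mul_one]
    ring
  refine admissible_of_sub_le h.curve₀ h.curve₁ hE ⟨hw, hslack.le_one⟩ (h.mean_mem p)
    (h.mean_mem q).1 ?_ ?_ (h.meanShiftBound.one_sub.sub_le_slack hE.1 hw hslack)
  · rw [hexp, mul_assoc]
    exact mul_le_mul_of_nonneg_left (h.shift₀ p) hE.1
  · rw [hmixture, mul_assoc]
    exact mul_le_mul_of_nonneg_left (h.shift₁ q) hw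

theorem admissible_exp_mixture (h : StepData A κ₀ κ₁ a₀ a₁ α) (hA : 5 / 4 ≤ A)
    (hπ : π ∈ Set.Icc 0 (1 / 2)) :
    Admissible κ₀ κ₁ (exp (-(A * π ^ 2)) * a₀) ((1 - (1 - π) * (1 - exp (-A))) * a₁) := by
  have hA' : 0 ≤ A := by linarith
  have hπ' : π ∈ Set.Icc 0 1 := ⟨hπ.1, by linarith [hπ.2]⟩
  rcases le_total 4 A with h4 | h4
  · exact h.admissible_exp_mixture_of_add_le hA' hπ' (exp_add_mixture_le_of_four_le h4 hπ)
  · obtain ⟨p, q, hp, hpπ, hslack⟩ := exists_slackSuffices ⟨hA, h4⟩ hπ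
    exact h.admissible_exp_mixture_of_slackSuffices hA' hπ' hp hpπ hslack

theorem admissible_updateFactor_of_le_half (h : StepData A κ₀ κ₁ a₀ a₁ α) (hA : 0 ≤ A)
    (hπ : π ∈ Set.Icc 0 (1 / 2)) :
    Admissible κ₀ κ₁ (updateFactor A π * a₀) (updateFactor A (1 - π) * a₁) := by
  obtain ⟨hπ0, hπ1⟩ := hπ
  unfold updateFactor
  rcases lt_or_ge (exp (-(A * π ^ 2))) (1 - π * (1 - exp (-A))) with h₀ | h₀
  · have h₁ := exp_neg_mul_sq_le_mixture_of_lt hA hπ0 (show π ≤ 1 - π by linarith)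
      (by linarith) h₀
    rw [max_eq_right h₀.le, max_eq_right h₁]
    exact h.admissible_mixture ⟨hπ0, by linarith⟩
  rw [max_eq_left h₀]
  rcases le_or_gt (1 - (1 - π) * (1 - exp (-A))) (exp (-(A * (1 - π) ^ 2))) with h₁ | h₁
  · rw [max_eq_left h₁]
    exact h.admissible_exp
  · have hA' : 5 / 4 ≤ A := by
      by_contra! hlt
      exact h₁.not_ge (mixture_le_exp_neg_mul_sq hA hlt.le (by linarith) (by linarith))
    rw [max_eq_right h₁.le]
    exact h.admissible_exp_mixture hA' ⟨hπ0, hπ1⟩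

theorem admissible_updateFactor (h : StepData A κ₀ κ₁ a₀ a₁ α) (hA : 0 ≤ A)
    (hπ : π ∈ Set.Icc 0 1) :
    Admissible κ₀ κ₁ (updateFactor A π * a₀) (updateFactor A (1 - π) * a₁) := by
  rcases le_total π (1 / 2) with hhalf | hhalf
  · exact h.admissible_updateFactor_of_le_half hA ⟨hπ.1, hhalf⟩
  have hreflect := h.reflect.admissible_updateFactor_of_le_half (π := 1 - π) hA
    ⟨sub_nonneg.2 hπ.2, by linarith⟩
  rw [sub_sub_cancel, ← mul_div_assoc, ← mul_div_assoc] at hreflect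
  exact hreflect.of_reflect (by linarith [h.curve₀.1]) (by linarith [h.curve₁.2])

theorem admissible_max (h : StepData A κ₀ κ₁ a₀ a₁ α) {E₀ E₁ : ℝ} (hE₀ : E₀ ∈ Set.Icc 0 1)
    (hE₁ : E₁ ∈ Set.Icc 0 1) (hadm : Admissible κ₀ κ₁ (E₀ * a₀) (E₁ * a₁)) :
    Admissible κ₀ κ₁ (max E₀ (2 / 21) * a₀) (max E₁ (2 / 21) * a₁) := by
  have hκ₀ := h.curve₀
  have hκ₁ := h.curve₁
  have hle₀ (x) (hx : x ∈ Set.Icc (0 : ℝ) 1) : x * a₀ ≤ 1 + κ₀ :=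
    (mul_le_mul_of_nonneg_left h.le_top hx.1).trans
      (mul_le_of_le_one_left (by linarith [hκ₀.1]) hx.2)
  have hle₁ (x) (hx : x ∈ Set.Icc (0 : ℝ) 1) : x * a₁ ≤ 1 :=
    (mul_le_mul_of_nonneg_left h.le_one hx.1).trans (by linarith [hx.2])
  rcases le_total (2 / 21) E₁ with h₁ | h₁
  · rcases le_total (2 / 21) E₀ with h₀ | h₀
    · rwa [max_eq_left h₀, max_eq_left h₁]
    · rw [max_eq_right h₀, max_eq_left h₁]
      exact ⟨0, by simp, by linarith [h.le_top, hκ₀.2], by linarith [hle₁ E₁ hE₁]⟩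
  · rw [max_eq_right h₁]
    have hmax : max E₀ (2 / 21) ∈ Set.Icc (0 : ℝ) 1 :=
      ⟨le_max_of_le_left hE₀.1, max_le hE₀.2 (by norm_num)⟩
    exact ⟨1, by simp, by linarith [hle₀ _ hmax], by linarith [h.le_one, hκ₁.2]⟩

end StepData

/-- The cost `min (f, g)` of an update, cut off at `log (21 / 2)`. -/
noncomputable def stepCost (A : ℝ) (u : Fin 2) (p : ℝ) : ℝ :=
  min (min (fTerm A u p) (gTerm A u p)) (log (21 / 2))

theorem updateFactor_mem_Icc {A r : ℝ} (hA : 0 ≤ A) (hr : 0 ≤ r) :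
    updateFactor A r ∈ Set.Icc 0 1 := by
  have hexp : 0 ≤ 1 - exp (-A) := sub_nonneg.2 (Real.exp_le_one_iff.2 (neg_nonpos.2 hA))
  exact ⟨le_max_of_le_left (exp_pos _).le,
    max_le (Real.exp_le_one_iff.2 (neg_nonpos.2 (by positivity))) (sub_le_self _ (by positivity))⟩

theorem abs_bit_sub_mem_Icc {p : ℝ} (hp : p ∈ Set.Icc 0 1) (u : Fin 2) :
    |((u : ℕ) : ℝ) - p| ∈ Set.Icc 0 1 := by
  refine ⟨abs_nonneg _, abs_le.2 ?_⟩
  fin_cases u <;> simp <;> constructor <;> linarith [hp.1, hp.2]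

theorem abs_one_sub_sub_bit {p : ℝ} (hp : p ∈ Set.Icc 0 1) (u : Fin 2) :
    |(1 - p) - ((u : ℕ) : ℝ)| = 1 - |((u : ℕ) : ℝ) - p| := by
  fin_cases u <;> simp [abs_of_nonneg hp.1, abs_of_nonneg (sub_nonneg.2 hp.2)]

theorem exp_neg_gTerm {A p : ℝ} (hA : 0 ≤ A) (hp : p ∈ Set.Icc 0 1) (u : Fin 2) :
    exp (-gTerm A u p) = 1 - |((u : ℕ) : ℝ) - p| * (1 - exp (-A)) := by
  have hexp : exp (-A) ≤ 1 := Real.exp_le_one_iff.2 (neg_nonpos.2 hA)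
  have hpos : 0 < 1 - |((u : ℕ) : ℝ) - p| * (1 - exp (-A)) := by
    linarith [mul_le_of_le_one_left (sub_nonneg.2 hexp) (abs_bit_sub_mem_Icc hp u).2, exp_pos (-A)]
  rw [← Real.exp_log hpos, gTerm, neg_neg, abs_one_sub_sub_bit hp]
  ring_nf

theorem exp_neg_min_fTerm_gTerm {A p : ℝ} (hA : 0 ≤ A) (hp : p ∈ Set.Icc 0 1) (u : Fin 2) :
    exp (-min (fTerm A u p) (gTerm A u p)) = updateFactor A |((u : ℕ) : ℝ) - p| := by
  rw [← max_neg_neg, Real.exp_monotone.map_max, exp_neg_gTerm hA hp, fTerm, updateFactor, sq_abs]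

theorem exp_neg_stepCost {A p : ℝ} (hA : 0 ≤ A) (hp : p ∈ Set.Icc 0 1) (u : Fin 2) :
    exp (-stepCost A u p) = max (updateFactor A |((u : ℕ) : ℝ) - p|) (2 / 21) := by
  rw [stepCost, ← max_neg_neg, Real.exp_monotone.map_max, exp_neg_min_fTerm_gTerm hA hp,
    ← Real.log_inv, Real.exp_log (by norm_num), inv_div]

theorem min_fTerm_gTerm_nonneg {A p : ℝ} (hA : 0 ≤ A) (hp : p ∈ Set.Icc 0 1) (u : Fin 2) :
    0 ≤ min (fTerm A u p) (gTerm A u p) := by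
  rw [← neg_nonpos, ← Real.exp_le_one_iff, exp_neg_min_fTerm_gTerm hA hp]
  exact (updateFactor_mem_Icc hA (abs_nonneg _)).2

theorem stepCost_nonneg {A p : ℝ} (hA : 0 ≤ A) (hp : p ∈ Set.Icc 0 1) (u : Fin 2) :
    0 ≤ stepCost A u p :=
  le_min (min_fTerm_gTerm_nonneg hA hp u) (Real.log_nonneg (by norm_num))

theorem StepData.admissible_stepCost {A π κ₀ κ₁ a₀ a₁ : ℝ} {α : ℝ → ℝ}
    (h : StepData A κ₀ κ₁ a₀ a₁ α) (hA : 0 ≤ A) (hπ : π ∈ Set.Icc 0 1) :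
    Admissible κ₀ κ₁ (exp (-stepCost A 0 π) * a₀) (exp (-stepCost A 1 π) * a₁) := by
  have h₀ : |(((0 : Fin 2) : ℕ) : ℝ) - π| = π := by simp [abs_of_nonneg hπ.1]
  have h₁ : |(((1 : Fin 2) : ℕ) : ℝ) - π| = 1 - π := by simp [abs_of_nonneg (sub_nonneg.2 hπ.2)]
  rw [exp_neg_stepCost hA hπ, exp_neg_stepCost hA hπ, h₀, h₁]
  exact h.admissible_max (updateFactor_mem_Icc hA hπ.1)
    (updateFactor_mem_Icc hA (sub_nonneg.2 hπ.2)) (h.admissible_updateFactor hA hπ)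

end SGLD

/-! ### Translates of the standard Gaussian law -/

namespace GaussianShift

variable {E : Type*} [NormedAddCommGroup E] [InnerProductSpace ℝ E]

/-- The density of the translate by `h` of the standard Gaussian law. -/
noncomputable def density (h x : E) : ℝ := exp (inner ℝ h x - ‖h‖ ^ 2 / 2)

theorem density_pos (h x : E) : 0 < density h x :=
  exp_pos _

theorem density_rpow (h : E) (r : ℝ) (x : E) :
    density h x ^ r = exp (-(r * (‖h‖ ^ 2 / 2))) * exp (inner ℝ (r • h) x) := by
  rw [density, ← Real.exp_mul, ← Real.exp_add, real_inner_smul_left]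
  ring_nf

variable [FiniteDimensional ℝ E] [MeasurableSpace E] [BorelSpace E]

theorem ext_of_integral_exp_inner {μ ν : Measure E} [IsProbabilityMeasure μ] [IsFiniteMeasure ν]
    (hμ : ∀ t : E, Integrable (fun x => exp (inner ℝ t x)) μ)
    (h : ∀ t : E, ∫ x, exp (inner ℝ t x) ∂μ = ∫ x, exp (inner ℝ t x) ∂ν) : μ = ν := by
  refine Measure.ext_of_charFun (funext fun t => ?_)
  have hmgf : mgf (inner ℝ t) μ = mgf (inner ℝ t) ν := funext fun r => by
    simpa only [mgf, real_inner_smul_left] using h (r • t)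
  have huniv : integrableExpSet (inner ℝ t) μ = Set.univ := Set.eq_univ_of_forall fun r => by
    simpa only [integrableExpSet, Set.mem_ofPred_eq, real_inner_smul_left] using hμ (r • t)
  have := eqOn_complexMGF_of_mgf hmgf (x := Complex.I) (by simp [huniv])
  simpa only [complexMGF, charFun_apply, real_inner_comm, mul_comm Complex.I] using this

theorem map_inner_stdGaussian (h : E) :
    (stdGaussian E).map (inner ℝ h) = gaussianReal 0 (‖h‖₊ ^ 2) := by
  have := IsGaussian.map_eq_gaussianReal (μ := stdGaussian E) (innerSL ℝ h)
  rwa [integral_strongDual_stdGaussian, variance_dual_stdGaussian, innerSL_apply_norm,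
    Real.toNNReal_pow (norm_nonneg h), norm_toNNReal] at this

theorem integrable_exp_inner (h : E) :
    Integrable (fun x : E => exp (inner ℝ h x)) (stdGaussian E) := by
  have := integrable_exp_mul_gaussianReal (μ := 0) (v := ‖h‖₊ ^ 2) 1
  simp only [one_mul] at this
  rw [← map_inner_stdGaussian, integrable_map_measure (by fun_prop) (by fun_prop)] at this
  exact this

theorem integral_exp_inner (h : E) :
    ∫ x : E, exp (inner ℝ h x) ∂(stdGaussian E) = exp (‖h‖ ^ 2 / 2) := by
  simpa [mgf] using mgf_gaussianReal (map_inner_stdGaussian h) 1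

theorem map_const_add_stdGaussian (h : E) :
    (stdGaussian E).map (h + ·) = (stdGaussian E).tilted (inner ℝ h) := by
  have : IsProbabilityMeasure ((stdGaussian E).map (h + ·)) :=
    Measure.isProbabilityMeasure_map (by fun_prop)
  have : IsProbabilityMeasure ((stdGaussian E).tilted (inner ℝ h)) :=
    isProbabilityMeasure_tilted (integrable_exp_inner h)
  refine ext_of_integral_exp_inner (fun t => ?_) fun t => ?_
  · rw [integrable_map_measure (by fun_prop) (by fun_prop)]
    simp only [Function.comp_def, inner_add_right, Real.exp_add]
    exact (integrable_exp_inner t).const_mul _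
  · rw [integral_map (by fun_prop) (by fun_prop), integral_exp_tilted]
    simp only [inner_add_right, Real.exp_add, Pi.add_apply, integral_const_mul, ← inner_add_left,
      integral_exp_inner, ← Real.exp_sub]
    rw [← Real.exp_add, norm_add_sq_real, real_inner_comm]
    ring_nf

theorem integral_add (h : E) (f : E → ℝ) :
    ∫ x, f (h + x) ∂(stdGaussian E) = ∫ x, density h x * f x ∂(stdGaussian E) := by
  have := (measurableEmbedding_addLeft h).integral_map (μ := stdGaussian E) f
  rw [← this, map_const_add_stdGaussian, integral_tilted]
  simp only [integral_exp_inner, ← Real.exp_sub, smul_eq_mul, density]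

theorem integrable_density_rpow (h : E) (r : ℝ) :
    Integrable (fun x => density h x ^ r) (stdGaussian E) := by
  simp only [density_rpow]
  exact (integrable_exp_inner _).const_mul _

theorem integral_density_rpow (h : E) (r : ℝ) :
    ∫ x, density h x ^ r ∂(stdGaussian E) = exp ((r ^ 2 - r) * (‖h‖ ^ 2 / 2)) := by
  simp only [density_rpow, integral_const_mul, integral_exp_inner, norm_smul, mul_pow,
    Real.norm_eq_abs, sq_abs]
  rw [← Real.exp_add]
  ring_nf

theorem memLp_density_rpow (h : E) (r : ℝ) :
    MemLp (fun x => density h x ^ r) 2 (stdGaussian E) := by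
  refine (memLp_two_iff_integrable_sq (integrable_density_rpow h r).aestronglyMeasurable).2 ?_
  simpa only [← Real.rpow_mul_natCast (density_pos h _).le] using
    integrable_density_rpow h (r * (2 : ℕ))

theorem sq_integral_mul_mul_le {α : Type*} [MeasurableSpace α] {μ : Measure α} {ψ u v : α → ℝ}
    (hψ : ∀ x, |ψ x| ≤ 1) (hu : MemLp u 2 μ) (hv : MemLp v 2 μ) :
    (∫ x, ψ x * (u x * v x) ∂μ) ^ 2 ≤ (∫ x, u x ^ 2 ∂μ) * ∫ x, v x ^ 2 ∂μ := by
  have hle : ‖∫ x, ψ x * (u x * v x) ∂μ‖ ≤ ∫ x, ‖u x‖ * ‖v x‖ ∂μ := by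
    refine norm_integral_le_of_norm_le (hu.norm.integrable_mul hv.norm) (ae_of_all _ fun x => ?_)
    rw [norm_mul, norm_mul]
    exact mul_le_of_le_one_left (by positivity) (hψ x)
  have hCS := hle.trans (integral_mul_norm_le_Lp_mul_Lq (p := 2) (q := 2) (f := u) (g := v)
    Real.HolderConjugate.two_two (by simpa using hu) (by simpa using hv))
  simp only [Real.rpow_two, Real.norm_eq_abs, sq_abs, ← Real.sqrt_eq_rpow] at hCS
  rw [← sq_abs, ← Real.sq_sqrt (mul_nonneg (integral_nonneg fun x => sq_nonneg (u x))
    (integral_nonneg fun x => sq_nonneg (v x))), Real.sqrt_mul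
    (integral_nonneg fun x => sq_nonneg (u x))]
  gcongr

theorem memLp_mul_density_rpow_add (h : E) (r a b : ℝ) :
    MemLp (fun x => a * density h x ^ r + b) 2 (stdGaussian E) :=
  ((memLp_density_rpow h r).const_mul a).add (memLp_const b)

theorem integral_sq_mul_density_rpow_add (h : E) (r a b : ℝ) :
    ∫ x, (a * density h x ^ r + b) ^ 2 ∂(stdGaussian E) =
      a ^ 2 * exp ((2 * r ^ 2 - r) * ‖h‖ ^ 2) +
        2 * a * b * exp ((r ^ 2 - r) * (‖h‖ ^ 2 / 2)) + b ^ 2 := by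
  have hsq (x : E) : (a * density h x ^ r + b) ^ 2 =
      a ^ 2 * density h x ^ (r * 2) + 2 * a * b * density h x ^ r + b ^ 2 := by
    rw [Real.rpow_mul (density_pos h x).le, Real.rpow_two]
    ring
  simp only [hsq]
  have hint (c r : ℝ) : Integrable (fun x => c * density h x ^ r) (stdGaussian E) :=
    (integrable_density_rpow h r).const_mul c
  rw [MeasureTheory.integral_add (by exact (hint _ _).add (hint _ _)) (integrable_const _),
    MeasureTheory.integral_add (hint _ _) (hint _ _), integral_const_mul, integral_const_mul,
    integral_density_rpow, integral_density_rpow, integral_const, probReal_univ, one_smul]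
  ring_nf

section MeanShift

variable {ψ : E → ℝ} (hψ : ∀ x, |ψ x| ≤ 1) (hm : Measurable ψ) (h : E)
include hψ hm

theorem mul_integral_add_sub_mul_integral (w₀ w₁ : ℝ) :
    w₁ * ∫ x, ψ (h + x) ∂stdGaussian E - w₀ * ∫ x, ψ x ∂stdGaussian E =
      ∫ x, ψ x * (w₁ * density h x - w₀) ∂stdGaussian E := by
  have hint : Integrable ψ (stdGaussian E) := .of_bound hm.aestronglyMeasurable 1 (ae_of_all _ hψ)
  have hρ : Integrable (density h) (stdGaussian E) := by simpa using integrable_density_rpow h 1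
  rw [integral_add, ← integral_const_mul, ← integral_const_mul,
    ← integral_sub ((hρ.mul_bdd hm.aestronglyMeasurable (ae_of_all _ hψ)).const_mul _)
      (hint.const_mul _)]
  exact integral_congr_ae (ae_of_all _ fun x => by ring)

theorem sq_mul_integral_add_sub_le_chiSq (w₀ w₁ : ℝ) :
    (w₁ * ∫ x, ψ (h + x) ∂stdGaussian E - w₀ * ∫ x, ψ x ∂stdGaussian E) ^ 2 ≤
      (w₁ - w₀) ^ 2 + w₁ ^ 2 * (exp (‖h‖ ^ 2) - 1) := by
  have hCS := sq_integral_mul_mul_le hψ (memLp_mul_density_rpow_add h 1 w₁ (-w₀)) (memLp_const 1)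
  rw [integral_sq_mul_density_rpow_add] at hCS
  rw [mul_integral_add_sub_mul_integral hψ hm]
  simp only [Real.rpow_one, mul_one, ← sub_eq_add_neg, integral_const, probReal_univ,
    one_smul] at hCS
  refine hCS.trans_eq ?_
  norm_num
  ring

theorem sq_mul_integral_add_sub_le_hellinger {w₀ w₁ : ℝ} (hw₀ : 0 ≤ w₀) (hw₁ : 0 ≤ w₁) :
    (w₁ * ∫ x, ψ (h + x) ∂stdGaussian E - w₀ * ∫ x, ψ x ∂stdGaussian E) ^ 2 ≤
      (w₁ - w₀) ^ 2 + 4 * w₀ * w₁ * (1 - exp (-(‖h‖ ^ 2 / 4))) := by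
  have hCS := sq_integral_mul_mul_le hψ (memLp_mul_density_rpow_add h (1 / 2) (√w₁) (-√w₀))
    (memLp_mul_density_rpow_add h (1 / 2) (√w₁) (√w₀))
  have hfactor (x : E) : (√w₁ * density h x ^ (1 / 2 : ℝ) + -√w₀) *
      (√w₁ * density h x ^ (1 / 2 : ℝ) + √w₀) = w₁ * density h x - w₀ := by
    rw [← Real.sqrt_eq_rpow]
    linear_combination (√(density h x)) ^ 2 * Real.sq_sqrt hw₁ - Real.sq_sqrt hw₀ +
      w₁ * Real.sq_sqrt (density_pos h x).le
  simp only [integral_sq_mul_density_rpow_add, hfactor] at hCS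
  rw [mul_integral_add_sub_mul_integral hψ hm]
  refine hCS.trans_eq ?_
  have hexp : exp (-(‖h‖ ^ 2 / 4)) = exp (-(‖h‖ ^ 2 / 8)) ^ 2 := by
    rw [← Real.exp_nat_mul]
    ring_nf
  rw [show (2 * (1 / 2 : ℝ) ^ 2 - 1 / 2) * ‖h‖ ^ 2 = 0 by ring, Real.exp_zero,
    show ((1 / 2 : ℝ) ^ 2 - 1 / 2) * (‖h‖ ^ 2 / 2) = -(‖h‖ ^ 2 / 8) by ring, hexp, neg_sq,
    Real.sq_sqrt hw₀, Real.sq_sqrt hw₁]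
  linear_combination (-4 * exp (-(‖h‖ ^ 2 / 8)) ^ 2) *
    (√w₀ ^ 2 * Real.sq_sqrt hw₁ + w₁ * Real.sq_sqrt hw₀)

end MeanShift

theorem exp_integral_le (h : E) {v g : E → ℝ} {C : ℝ} (hv : Integrable v (stdGaussian E))
    (hg : Measurable g) (hgC : ∀ x, g x ≤ C) (hvg : ∀ x, exp (v x) ≤ g x) :
    exp (∫ x, v x ∂stdGaussian E) ≤ exp (‖h‖ ^ 2 / 2) * ∫ x, g (h + x) ∂stdGaussian E := by
  have hlin : Integrable (fun x : E => (inner ℝ h x : ℝ)) (stdGaussian E) :=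
    IsGaussian.integrable_id.const_inner (𝕜 := ℝ) h
  have hmean : ∫ x, (inner ℝ h x : ℝ) ∂stdGaussian E = 0 :=
    integral_strongDual_stdGaussian (innerSL ℝ h)
  have hdom : Integrable (fun x => exp (inner ℝ h x) * g x) (stdGaussian E) :=
    (integrable_exp_inner h).mul_bdd hg.aestronglyMeasurable (ae_of_all _ fun x =>
      (Real.norm_of_nonneg ((exp_pos _).le.trans (hvg x))).trans_le (hgC x))
  have hle (x : E) : exp (inner ℝ h x + v x) ≤ exp (inner ℝ h x) * g x := by
    rw [Real.exp_add]
    gcongr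
    exact hvg x
  have hint : Integrable (fun x => exp (inner ℝ h x + v x)) (stdGaussian E) :=
    hdom.mono' (Real.continuous_exp.comp_aestronglyMeasurable (hlin.add hv).aestronglyMeasurable)
      (ae_of_all _ fun x => (Real.norm_of_nonneg (exp_pos _).le).trans_le (hle x))
  calc exp (∫ x, v x ∂stdGaussian E)
      = exp (∫ x, (inner ℝ h x + v x) ∂stdGaussian E) := by
        rw [MeasureTheory.integral_add hlin hv, hmean, zero_add]
    _ ≤ ∫ x, exp (inner ℝ h x + v x) ∂stdGaussian E :=
        convexOn_exp.map_integral_le Real.continuous_exp.continuousOn isClosed_univ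
          (ae_of_all _ fun _ => Set.mem_univ _) (hlin.add hv) hint
    _ ≤ ∫ x, exp (inner ℝ h x) * g x ∂stdGaussian E := integral_mono hint hdom hle
    _ = _ := by
        rw [integral_add, ← integral_const_mul]
        simp only [density, Real.exp_sub]
        field_simp

end GaussianShift

namespace SGLD

section GaussianStep

variable {E : Type*} [NormedAddCommGroup E] [InnerProductSpace ℝ E] [FiniteDimensional ℝ E]
  [MeasurableSpace E] [BorelSpace E] {s : E → ℝ} (hs : Measurable s)
  (hs' : ∀ x, s x ∈ Set.Icc 0 1)
include hs hs'

theorem meanShiftBound_integral_stdGaussian (b δ : E) :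
    MeanShiftBound (‖δ‖ ^ 2 / 2) fun p => ∫ e, s (b + p • δ + e) ∂stdGaussian E := by
  intro p q E' w hE hw
  set ψ : E → ℝ := fun e => 2 * s (b + p • δ + e) - 1 with hψdef
  have hψ : ∀ e, |ψ e| ≤ 1 := fun e => by
    obtain ⟨h0, h1⟩ := hs' (b + p • δ + e)
    exact abs_le.2 ⟨by linarith, by linarith⟩
  have hm : Measurable ψ := by fun_prop
  have hint (c : E) : ∫ e, (2 * s (c + e) - 1) ∂stdGaussian E =
      2 * ∫ e, s (c + e) ∂stdGaussian E - 1 := by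
    have : Integrable (fun e => s (c + e)) (stdGaussian E) :=
      .of_mem_Icc 0 1 (by fun_prop) (ae_of_all _ fun e => hs' _)
    rw [integral_sub (this.const_mul 2) (integrable_const 1), integral_const_mul]
    simp
  have hshift (e : E) : ψ ((q - p) • δ + e) = 2 * s (b + q • δ + e) - 1 := by
    simp only [hψdef]
    congr 3
    module
  have hnorm : ‖(q - p) • δ‖ ^ 2 = 2 * (‖δ‖ ^ 2 / 2 * (q - p) ^ 2) := by
    rw [norm_smul, mul_pow, Real.norm_eq_abs, sq_abs]
    ring
  have h₁ := GaussianShift.sq_mul_integral_add_sub_le_chiSq hψ hm ((q - p) • δ) E' w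
  have h₂ := GaussianShift.sq_mul_integral_add_sub_le_hellinger hψ hm ((q - p) • δ) hE hw
  simp only [hshift, hint, hnorm] at h₁ h₂
  simp only [hψdef, hint] at h₁ h₂
  rw [← min_add_add_left, le_min_iff]
  constructor
  · refine le_trans (le_of_eq ?_) h₁
    ring
  · refine (le_of_eq ?_).trans (h₂.trans_eq ?_) <;> ring_nf

theorem exp_neg_mul_exp_integral_le {v : E → ℝ} {κ : ℝ} (b h : E)
    (hv : Integrable (fun e => v (b + e)) (stdGaussian E)) (hle : ∀ x, exp (v x) ≤ 1 + κ * s x) :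
    exp (-(‖h‖ ^ 2 / 2)) * exp (∫ e, v (b + e) ∂stdGaussian E) ≤
      1 + κ * ∫ e, s (b + h + e) ∂stdGaussian E := by
  have hint : Integrable (fun e => s (b + h + e)) (stdGaussian E) :=
    .of_mem_Icc 0 1 (by fun_prop) (ae_of_all _ fun e => hs' _)
  have hbdd (x : E) : 1 + κ * s (b + x) ≤ 1 + |κ| := by
    obtain ⟨hs₀, hs₁⟩ := hs' (b + x)
    linarith [mul_le_mul_of_nonneg_right (le_abs_self κ) hs₀,
      mul_le_mul_of_nonneg_left hs₁ (abs_nonneg κ)]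
  have hshift := GaussianShift.exp_integral_le h hv (by fun_prop) hbdd fun e => hle _
  simp only [← add_assoc] at hshift
  rw [integral_add (integrable_const 1) (hint.const_mul κ), integral_const_mul,
    integral_const, probReal_univ, one_smul] at hshift
  rwa [Real.exp_neg, inv_mul_le_iff₀ (exp_pos _)]

theorem stepData_integral_stdGaussian {v₀ v₁ : E → ℝ} {κ₀ κ₁ : ℝ} (b₀ b₁ : E)
    (hκ₀ : κ₀ ∈ Set.Ioc 0 (19 / 2)) (hκ₁ : κ₁ ∈ Set.Ioc 0 (19 / 21))
    (hv₀ : Integrable (fun e => v₀ (b₀ + e)) (stdGaussian E))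
    (hv₁ : Integrable (fun e => v₁ (b₁ + e)) (stdGaussian E))
    (h₀ : ∀ x, exp (v₀ x) ≤ 1 + κ₀ * s x) (h₁ : ∀ x, exp (v₁ x) ≤ 1 - κ₁ * s x) :
    StepData (‖b₁ - b₀‖ ^ 2 / 2) κ₀ κ₁ (exp (∫ e, v₀ (b₀ + e) ∂stdGaussian E))
      (exp (∫ e, v₁ (b₁ + e) ∂stdGaussian E))
      fun p => ∫ e, s (b₀ + p • (b₁ - b₀) + e) ∂stdGaussian E := by
  have hnorm (p : ℝ) : ‖p • (b₁ - b₀)‖ ^ 2 / 2 = ‖b₁ - b₀‖ ^ 2 / 2 * p ^ 2 := by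
    rw [norm_smul, mul_pow, Real.norm_eq_abs, sq_abs]
    ring
  refine ⟨hκ₀, hκ₁, fun p => ?_, fun p => ?_, fun p => ?_,
    meanShiftBound_integral_stdGaussian hs hs' b₀ (b₁ - b₀)⟩
  · exact (convex_Icc 0 1).integral_mem isClosed_Icc (ae_of_all _ fun e => hs' _)
      (.of_mem_Icc 0 1 (by fun_prop) (ae_of_all _ fun e => hs' _))
  · rw [← hnorm]
    exact exp_neg_mul_exp_integral_le hs hs' b₀ _ hv₀ h₀
  · have hend : b₁ + -((1 - p) • (b₁ - b₀)) = b₀ + p • (b₁ - b₀) := by module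
    rw [← hnorm, ← norm_neg, ← hend, sub_eq_add_neg 1 (κ₁ * _), ← neg_mul]
    exact exp_neg_mul_exp_integral_le hs hs' b₁ _ hv₁ fun x => (h₁ x).trans_eq (by ring)

theorem admissible_exp_integral_sub_stepCost {v₀ v₁ : E → ℝ} {κ₀ κ₁ π : ℝ} (b₀ b₁ : E)
    (hκ₀ : κ₀ ∈ Set.Ioc 0 (19 / 2)) (hκ₁ : κ₁ ∈ Set.Ioc 0 (19 / 21)) (hπ : π ∈ Set.Icc 0 1)
    (hv₀ : Integrable (fun e => v₀ (b₀ + e)) (stdGaussian E))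
    (hv₁ : Integrable (fun e => v₁ (b₁ + e)) (stdGaussian E))
    (h₀ : ∀ x, exp (v₀ x) ≤ 1 + κ₀ * s x) (h₁ : ∀ x, exp (v₁ x) ≤ 1 - κ₁ * s x) :
    Admissible κ₀ κ₁
      (exp (∫ e, v₀ (b₀ + e) ∂stdGaussian E - stepCost (‖b₁ - b₀‖ ^ 2 / 2) 0 π))
      (exp (∫ e, v₁ (b₁ + e) ∂stdGaussian E - stepCost (‖b₁ - b₀‖ ^ 2 / 2) 1 π)) := by
  simp only [Real.exp_sub, div_eq_mul_inv, ← Real.exp_neg, mul_comm (exp (∫ _, _ ∂_))]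
  exact (stepData_integral_stdGaussian hs hs' b₀ b₁ hκ₀ hκ₁ hv₀ hv₁ h₀ h₁).admissible_stepCost
    (by positivity) hπ

end GaussianStep

/-! ### Linearisation of the square root -/

theorem one_sub_add_mul_exp_le {s : ℝ} (hs : s ∈ Set.Icc 0 1) (l : ℝ) :
    1 - s + s * exp l ≤ exp (l * s + l ^ 2 / 8) := by
  have hmem : ∀ᵐ x ∂bernoulliMeasure (1 : ℝ) 0 ⟨s, hs⟩, id x ∈ Set.Icc (0 : ℝ) 1 := by
    rw [bernoulliMeasure_def, ae_add_measure_iff]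
    constructor <;> exact Measure.ae_smul_measure (by simp [ae_dirac_eq]) _
  have hmgf := (hasSubgaussianMGF_of_mem_Icc aemeasurable_id hmem).mgf_le l
  simp only [mgf, integral_bernoulliMeasure, smul_eq_mul, id] at hmgf
  norm_num at hmgf
  calc 1 - s + s * exp l
      = exp (l * s) * (s * exp (l * (1 - s)) + (1 - s) * exp (-(l * s))) := by
        rw [mul_one_sub, Real.exp_sub, Real.exp_neg]
        field_simp
        ring
    _ ≤ exp (l * s) * exp (1 / 4 * l ^ 2 / 2) := by gcongr
    _ = exp (l * s + l ^ 2 / 8) := by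
        rw [← Real.exp_add]
        ring_nf

theorem pow_mul_le_exp_neg (n : ℕ) {y : ℝ} (hy : y ≤ 1 + n / 8) :
    (0.88248 : ℝ) ^ n * (1 + n / 8 - y) ≤ exp (-y) := by
  have hexp : (0.88248 : ℝ) ≤ exp (-(1 / 8)) := by
    refine le_of_pow_le_pow_left₀ (n := 8) (by norm_num) (exp_pos _).le ?_
    rw [← Real.exp_nat_mul]
    norm_num
    linarith [Real.exp_neg_one_gt_d9]
  calc (0.88248 : ℝ) ^ n * (1 + n / 8 - y)
      ≤ exp (-(1 / 8)) ^ n * exp (n / 8 - y) := by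
        have := sub_nonneg.2 hy
        gcongr
        linarith [Real.add_one_le_exp ((n : ℝ) / 8 - y)]
    _ = exp (-y) := by
        rw [← Real.exp_nat_mul, ← Real.exp_add]
        ring_nf

-- The ratio of the two sides comes close to `1` near `s = 0.79`, so several tangents are needed.
theorem one_sub_mul_le_exp_neg_sq {s : ℝ} (hs : s ∈ Set.Icc 0 1) :
    1 - 19 / 21 * s ≤ exp (-(2 * s ^ 2)) := by
  obtain ⟨hs₀, hs₁⟩ := hs
  have of_tangent (n : ℕ) (hn : 2 * s ^ 2 ≤ 1 + n / 8)
      (h : 1 - 19 / 21 * s ≤ 0.88248 ^ n * (1 + n / 8 - 2 * s ^ 2)) :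
      1 - 19 / 21 * s ≤ exp (-(2 * s ^ 2)) := h.trans (pow_mul_le_exp_neg n hn)
  rcases le_total s 0.45 with h₁ | h₁
  · exact of_tangent 0 (by norm_num; nlinarith) (by norm_num; nlinarith)
  rcases le_total s 0.59 with h₂ | h₂
  · exact of_tangent 3 (by norm_num; nlinarith) (by norm_num; nlinarith)
  rcases le_total s 0.69 with h₃ | _
  · exact of_tangent 6 (by norm_num; nlinarith) (by norm_num; nlinarith)
  rcases le_total s 0.75 with h₄ | h₄
  · exact of_tangent 8 (by push_cast; nlinarith) (by norm_num; nlinarith)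
  rcases le_total s 0.84 with h₅ | h₅
  · exact of_tangent 10 (by norm_num; nlinarith) (by norm_num; nlinarith)
  · exact of_tangent 12 (by norm_num; nlinarith) (by norm_num; nlinarith)

theorem one_sub_min_mul_le_exp {s : ℝ} (hs : s ∈ Set.Icc 0 1) (l : ℝ) :
    1 - min (1 - exp (-l)) (19 / 21) * s ≤ exp (-(l * s) + l ^ 2 / 8) := by
  rcases min_choice (1 - exp (-l)) (19 / 21) with h | h <;> rw [h]
  · convert one_sub_add_mul_exp_le hs (-l) using 1
    · ring
    · ring_nf
  · refine (one_sub_mul_le_exp_neg_sq hs).trans (Real.exp_le_exp.2 ?_)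
    linarith [sq_nonneg (4 * s - l)]

theorem Admissible.sub_le {x y D₀ D₁ l₀ l₁ : ℝ} (hl₀ : 0 < l₀) (hl₁ : 0 < l₁)
    (h : Admissible (exp l₀ - 1) (min (1 - exp (-l₁)) (19 / 21)) (exp (l₀ * x - D₀))
      (exp (-(l₁ * y) - D₁))) :
    x - y ≤ D₀ / l₀ + D₁ / l₁ + (l₀ + l₁) / 8 := by
  obtain ⟨s, hs, hs₀, hs₁⟩ := h
  have h₀ : l₀ * x - D₀ ≤ l₀ * s + l₀ ^ 2 / 8 :=
    Real.exp_le_exp.1 (hs₀.trans ((one_sub_add_mul_exp_le hs l₀).trans' (by linarith)))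
  have h₁ : -(l₁ * y) - D₁ ≤ -(l₁ * s) + l₁ ^ 2 / 8 :=
    Real.exp_le_exp.1 (hs₁.trans (one_sub_min_mul_le_exp hs l₁))
  have h₀' : x - s ≤ D₀ / l₀ + l₀ / 8 := by
    refine le_of_mul_le_mul_left ?_ hl₀
    field_simp
    linarith
  have h₁' : s - y ≤ D₁ / l₁ + l₁ / 8 := by
    refine le_of_mul_le_mul_left ?_ hl₁
    field_simp
    linarith
  linarith

theorem two_le_log : 2 ≤ log (21 / 2) := by
  rw [Real.le_log_iff_exp_le (by norm_num), show (2 : ℝ) = (2 : ℕ) * 1 by norm_num,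
    Real.exp_nat_mul]
  nlinarith [Real.exp_one_lt_d9, exp_pos 1]

theorem sub_le_sqrt_add_sqrt {x y D₀ D₁ : ℝ} (hxy : x - y ≤ 1)
    (h : ∀ l₀ l₁ : ℝ, 0 < l₀ → 0 < l₁ → min l₀ l₁ ≤ log (21 / 2) →
      x - y ≤ D₀ / l₀ + D₁ / l₁ + (l₀ + l₁) / 8) :
    x - y ≤ √(D₀ / 2) + √(D₁ / 2) := by
  have hdiv {D r : ℝ} (hr : 0 < r) (hD : √(D / 2) < r) : D / (4 * r) ≤ r / 2 := by
    rw [Real.sqrt_lt' hr] at hD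
    rw [div_le_iff₀ (by positivity)]
    linarith
  have hlt {r₀ r₁ : ℝ} (hr₀ : √(D₀ / 2) < r₀) (hr₁ : √(D₁ / 2) < r₁) : x - y ≤ r₀ + r₁ := by
    have hpos₀ := (Real.sqrt_nonneg _).trans_lt hr₀
    have hpos₁ := (Real.sqrt_nonneg _).trans_lt hr₁
    rcases le_or_gt (min (4 * r₀) (4 * r₁)) (log (21 / 2)) with hmin | hmin
    · linarith [h (4 * r₀) (4 * r₁) (by positivity) (by positivity) hmin, hdiv hpos₀ hr₀,
        hdiv hpos₁ hr₁]
    · linarith [two_le_log, (lt_min_iff.1 hmin).1, (lt_min_iff.1 hmin).2]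
  refine le_of_forall_pos_le_add fun ε hε => ?_
  linarith [hlt (lt_add_of_pos_right _ (half_pos hε)) (lt_add_of_pos_right _ (half_pos hε))]

/-! ### Controlled Markov chains -/

section Chain

variable {X E : Type*} {T : ℕ}

/-- The states of a controlled system with transitions `step`, from the initial state `x` and with
the noise `ε`. The entry `t : Fin T` of `step` and `ε` leads from the state number `t` to the state
number `t + 1`. -/
def chain (step : Fin T → X → E → X) (x : X) (ε : Fin T → E) : Fin (T + 1) → X :=
  Fin.induction x fun t y => step t y (ε t)

theorem chain_cons_succ (step : Fin (T + 1) → X → E → X) (x : X) (e : E) (ε : Fin T → E)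
    (t : Fin (T + 1)) :
    chain step x (Fin.cons e ε) t.succ = chain (fun k => step k.succ) (step 0 x e) ε t := by
  induction t using Fin.induction with
  | zero => rfl
  | succ t ih => exact congrArg (step t.succ · (ε t)) ih

/-- The terminal reward `v` minus the running costs `c` along a chain. -/
def chainReward (step : Fin T → X → E → X) (c : Fin T → X → ℝ) (v : X → ℝ) (x : X)
    (ε : Fin T → E) : ℝ :=
  v (chain step x ε (Fin.last T)) - ∑ t, c t (chain step x ε t.castSucc)

theorem chainReward_cons (step : Fin (T + 1) → X → E → X) (c : Fin (T + 1) → X → ℝ) (v : X → ℝ)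
    (x : X) (e : E) (ε : Fin T → E) :
    chainReward step c v x (Fin.cons e ε) =
      chainReward (fun t => step t.succ) (fun t => c t.succ) v (step 0 x e) ε - c 0 x := by
  rw [chainReward, ← Fin.succ_last, chain_cons_succ, Fin.sum_univ_succ, add_comm (c 0 _), ← sub_sub]
  simp only [← Fin.succ_castSucc, chain_cons_succ]
  rfl

theorem abs_chainReward_le {step : Fin T → X → E → X} {c : Fin T → X → ℝ} {v : X → ℝ} {B C : ℝ}
    (hvC : ∀ x, |v x| ≤ C) (hcB : ∀ t x, |c t x| ≤ B) (x : X) (ε : Fin T → E) :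
    |chainReward step c v x ε| ≤ C + T * B := by
  refine (abs_sub _ _).trans (add_le_add (hvC _) ((Finset.abs_sum_le_sum_abs _ _).trans ?_))
  exact (Finset.sum_le_card_nsmul _ _ B fun t _ => hcB t _).trans_eq (by simp)

variable [MeasurableSpace E]

/-- The expected reward of the chain started at `x`, when the noise is i.i.d. with law `ν`. -/
noncomputable def chainValue (ν : Measure E) (step : Fin T → X → E → X) (c : Fin T → X → ℝ)
    (v : X → ℝ) (x : X) : ℝ :=
  ∫ ε, chainReward step c v x ε ∂Measure.pi fun _ => ν

variable {ν : Measure E} [IsProbabilityMeasure ν] {c : Fin T → X → ℝ} {v : X → ℝ} {B C : ℝ}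

theorem abs_chainValue_le {step : Fin T → X → E → X} (hvC : ∀ x, |v x| ≤ C)
    (hcB : ∀ t x, |c t x| ≤ B) (x : X) : |chainValue ν step c v x| ≤ C + T * B := by
  simpa [chainValue] using norm_integral_le_of_norm_le_const (μ := Measure.pi fun _ : Fin T => ν)
    (f := chainReward step c v x) (ae_of_all _ fun ε => abs_chainReward_le hvC hcB x ε)

variable [MeasurableSpace X]

theorem measurable_chain {step : Fin T → X → E → X}
    (hstep : ∀ t, Measurable (Function.uncurry (step t))) (t : Fin (T + 1)) :
    Measurable fun p : X × (Fin T → E) => chain step p.1 p.2 t := by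
  induction t using Fin.induction with
  | zero => exact measurable_fst
  | succ t ih => exact (hstep t).comp (ih.prodMk ((measurable_pi_apply t).comp measurable_snd))

theorem measurable_chainReward {step : Fin T → X → E → X}
    (hstep : ∀ t, Measurable (Function.uncurry (step t))) (hc : ∀ t, Measurable (c t))
    (hv : Measurable v) : Measurable (Function.uncurry (chainReward step c v)) :=
  (hv.comp (measurable_chain hstep _)).sub
    (Finset.measurable_sum _ fun t _ => (hc t).comp (measurable_chain hstep _))

theorem measurable_chainValue {step : Fin T → X → E → X}
    (hstep : ∀ t, Measurable (Function.uncurry (step t))) (hc : ∀ t, Measurable (c t))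
    (hv : Measurable v) : Measurable (chainValue ν step c v) :=
  (measurable_chainReward hstep hc hv).stronglyMeasurable.integral_prod_right.measurable

theorem chainValue_succ {step : Fin (T + 1) → X → E → X} {c : Fin (T + 1) → X → ℝ}
    (hstep : ∀ t, Measurable (Function.uncurry (step t))) (hc : ∀ t, Measurable (c t))
    (hv : Measurable v) (hvC : ∀ x, |v x| ≤ C) (hcB : ∀ t x, |c t x| ≤ B) (x : X) :
    chainValue ν step c v x =
      ∫ e, chainValue ν (fun t => step t.succ) (fun t => c t.succ) v (step 0 x e) ∂ν - c 0 x := by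
  have hint : Integrable (fun p : E × (Fin T → E) =>
      chainReward (fun t => step t.succ) (fun t => c t.succ) v (step 0 x p.1) p.2)
      (ν.prod (Measure.pi fun _ => ν)) :=
    .of_bound ((measurable_chainReward (fun t => hstep t.succ) (fun t => hc t.succ) hv).comp
      (((hstep 0).comp (measurable_const.prodMk measurable_fst)).prodMk
        measurable_snd)).aestronglyMeasurable
      (C + T * B) (ae_of_all _ fun p => abs_chainReward_le hvC (fun t => hcB t.succ) _ _)
  calc chainValue ν step c v x
      = ∫ p : E × (Fin T → E), chainReward step c v x (Fin.cons p.1 p.2)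
          ∂ν.prod (Measure.pi fun _ => ν) :=
        ((measurePreserving_piFinSuccAbove (fun _ => ν) 0).symm.integral_comp'
          (chainReward step c v x)).symm.trans (by
            simp [MeasurableEquiv.piFinSuccAbove_symm_apply, Fin.consEquiv])
    _ = _ := by
        simp only [chainReward_cons]
        rw [integral_sub hint (integrable_const _), integral_prod _ hint]
        simp [chainValue]

end Chain

/-! ### Backward recursion for a system driven by an unknown bit -/

@[fun_prop]
theorem measurable_fTerm (u : Fin 2) : Measurable fun q : ℝ × ℝ => fTerm q.1 u q.2 := by
  unfold fTerm
  fun_prop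

@[fun_prop]
theorem measurable_gTerm (u : Fin 2) : Measurable fun q : ℝ × ℝ => gTerm q.1 u q.2 := by
  unfold gTerm
  fun_prop

theorem measurable_stepCost (u : Fin 2) : Measurable fun q : ℝ × ℝ => stepCost q.1 u q.2 :=
  ((measurable_fTerm u).min (measurable_gTerm u)).min measurable_const

theorem fTerm_one_sub (A p : ℝ) (u : Fin 2) : fTerm A (1 - u) (1 - p) = fTerm A u p := by
  fin_cases u
  · simp [fTerm]
  · simp only [fTerm, Fin.mk_one, sub_self, Fin.coe_ofNat_eq_mod]
    ring

theorem gTerm_one_sub (A p : ℝ) (u : Fin 2) : gTerm A (1 - u) (1 - p) = gTerm A u p := by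
  fin_cases u <;> simp [gTerm, abs_sub_comm]

theorem stepCost_one_sub (A p : ℝ) (u : Fin 2) : stepCost A (1 - u) (1 - p) = stepCost A u p := by
  rw [stepCost, stepCost, fTerm_one_sub, gTerm_one_sub]

theorem exists_measurable_curve {X : Type*} [MeasurableSpace X] {κ₀ κ₁ : ℝ} {x₀ x₁ : X → ℝ}
    (hκ₀ : 0 < κ₀) (hκ₁ : 0 ≤ κ₁) (hx₀ : Measurable x₀) (h : ∀ x, Admissible κ₀ κ₁ (x₀ x) (x₁ x)) :
    ∃ s : X → ℝ, Measurable s ∧ (∀ x, s x ∈ Set.Icc 0 1) ∧ (∀ x, x₀ x ≤ 1 + κ₀ * s x) ∧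
      ∀ x, x₁ x ≤ 1 - κ₁ * s x := by
  refine ⟨fun x => max 0 ((x₀ x - 1) / κ₀), by fun_prop, fun x => ?_, fun x => ?_, fun x => ?_⟩
  all_goals
    obtain ⟨s, hs, hs₀, hs₁⟩ := h x
    have hle : (x₀ x - 1) / κ₀ ≤ s := (div_le_iff₀' hκ₀).2 (by linarith)
  · exact ⟨le_max_left _ _, max_le zero_le_one (hle.trans hs.2)⟩
  · linarith [(div_le_iff₀' hκ₀).1 (le_max_right 0 ((x₀ x - 1) / κ₀))]
  · linarith [mul_le_mul_of_nonneg_left (max_le hs.1 hle) hκ₁]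

/-- A system whose update adds a drift, which depends on a bit, and a Gaussian noise in `E`,
together with an estimate of the probability that the bit is one. The entry `t` of each field
belongs to the update from the state number `t` to the state number `t + 1`; the new state is
`transition t x y`, where `x` is the old state and `y` is the drift plus the noise. -/
structure BitSystem (T : ℕ) (X E : Type*) [MeasurableSpace X] [MeasurableSpace E] where
  transition : Fin T → X → E → X
  drift : Fin 2 → Fin T → X → E
  estimate : Fin T → X → ℝ
  measurable_transition (t : Fin T) : Measurable (Function.uncurry (transition t))
  measurable_drift (u : Fin 2) (t : Fin T) : Measurable (drift u t)
  measurable_estimate (t : Fin T) : Measurable (estimate t)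
  estimate_mem (t : Fin T) (x : X) : estimate t x ∈ Set.Icc 0 1

namespace BitSystem

variable {T : ℕ} {X E : Type*} [MeasurableSpace X] [NormedAddCommGroup E]
  [MeasurableSpace E]

/-- The transition of the system for the bit value `u`, as a function of the noise. -/
def step (S : BitSystem T X E) (u : Fin 2) (t : Fin T) (x : X) (e : E) : X :=
  S.transition t x (S.drift u t x + e)

/-- The cost of the update `t` from the state `x`, for the bit value `u`. -/
noncomputable def cost (S : BitSystem T X E) (u : Fin 2) (t : Fin T) (x : X) : ℝ :=
  stepCost (‖S.drift 1 t x - S.drift 0 t x‖ ^ 2 / 2) u (S.estimate t x)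

/-- The system without its first update. -/
def tail (S : BitSystem (T + 1) X E) : BitSystem T X E where
  transition t := S.transition t.succ
  drift u t := S.drift u t.succ
  estimate t := S.estimate t.succ
  measurable_transition t := S.measurable_transition t.succ
  measurable_drift u t := S.measurable_drift u t.succ
  measurable_estimate t := S.measurable_estimate t.succ
  estimate_mem t := S.estimate_mem t.succ

/-- The system with the two bit values exchanged. -/
def swap (S : BitSystem T X E) : BitSystem T X E where
  transition := S.transition
  drift u := S.drift (1 - u)
  estimate t x := 1 - S.estimate t x
  measurable_transition := S.measurable_transition
  measurable_drift u := S.measurable_drift (1 - u)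
  measurable_estimate t := measurable_const.sub (S.measurable_estimate t)
  estimate_mem t x := ⟨sub_nonneg.2 (S.estimate_mem t x).2, sub_le_self _ (S.estimate_mem t x).1⟩

theorem cost_swap (S : BitSystem T X E) (u : Fin 2) (t : Fin T) (x : X) :
    S.swap.cost u t x = S.cost (1 - u) t x := by
  rw [cost, cost, ← stepCost_one_sub _ (S.estimate t x) (1 - u), sub_sub_self, norm_sub_rev]
  rfl

theorem cost_mem_Icc (S : BitSystem T X E) (u : Fin 2) (t : Fin T) (x : X) :
    S.cost u t x ∈ Set.Icc 0 (log (21 / 2)) :=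
  ⟨stepCost_nonneg (by positivity) (S.estimate_mem t x) u, min_le_right _ _⟩

theorem abs_cost_le (S : BitSystem T X E) (u : Fin 2) (t : Fin T) (x : X) :
    |S.cost u t x| ≤ log (21 / 2) :=
  (abs_of_nonneg (S.cost_mem_Icc u t x).1).trans_le (S.cost_mem_Icc u t x).2

variable [BorelSpace E] [SecondCountableTopology E]

theorem measurable_step (S : BitSystem T X E) (u : Fin 2) (t : Fin T) :
    Measurable (Function.uncurry (S.step u t)) :=
  (S.measurable_transition t).comp
    (measurable_fst.prodMk (((S.measurable_drift u t).comp measurable_fst).add measurable_snd))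

theorem measurable_cost (S : BitSystem T X E) (u : Fin 2) (t : Fin T) : Measurable (S.cost u t) :=
  (measurable_stepCost u).comp
    (((((S.measurable_drift 1 t).sub (S.measurable_drift 0 t)).norm.pow_const 2).div_const 2).prodMk
      (S.measurable_estimate t))

end BitSystem

namespace BitSystem

variable {T : ℕ} {X E : Type*} [MeasurableSpace X] [NormedAddCommGroup E] [InnerProductSpace ℝ E]
  [FiniteDimensional ℝ E] [MeasurableSpace E] [BorelSpace E]

theorem admissible_chainValue {κ₀ κ₁ C : ℝ} (hκ₀ : κ₀ ∈ Set.Ioc 0 (19 / 2))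
    (hκ₁ : κ₁ ∈ Set.Ioc 0 (19 / 21)) {v : Fin 2 → X → ℝ} (hv : ∀ u, Measurable (v u))
    (hvC : ∀ u x, |v u x| ≤ C) (h : ∀ x, Admissible κ₀ κ₁ (exp (v 0 x)) (exp (v 1 x)))
    (S : BitSystem T X E) (x : X) :
    Admissible κ₀ κ₁ (exp (chainValue (stdGaussian E) (S.step 0) (S.cost 0) (v 0) x))
      (exp (chainValue (stdGaussian E) (S.step 1) (S.cost 1) (v 1) x)) := by
  induction T generalizing x with
  | zero => simpa [chainValue, chainReward, chain] using h x
  | succ T ih =>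
    set w : Fin 2 → X → ℝ := fun u =>
      chainValue (stdGaussian E) (S.tail.step u) (S.tail.cost u) (v u)
    have hw (u : Fin 2) : Measurable (w u) :=
      measurable_chainValue (S.tail.measurable_step u) (S.tail.measurable_cost u) (hv u)
    obtain ⟨s, hs, hs', hs₀, hs₁⟩ :=
      exists_measurable_curve hκ₀.1 hκ₁.1.le (hw 0).exp (ih S.tail)
    have htrans : Measurable (S.transition 0 x) :=
      (S.measurable_transition 0).comp measurable_prodMk_left
    have hint (u : Fin 2) (b : E) :
        Integrable (fun e => w u (S.transition 0 x (b + e))) (stdGaussian E) :=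
      .of_bound ((hw u).comp (htrans.comp (measurable_const_add b))).aestronglyMeasurable _
        (ae_of_all _ fun e => abs_chainValue_le (hvC u) (S.tail.abs_cost_le u) _)
    simp only [chainValue_succ (S.measurable_step _) (S.measurable_cost _) (hv _) (hvC _)
      (S.abs_cost_le _)]
    exact admissible_exp_integral_sub_stepCost (hs.comp htrans) (fun y => hs' _) _ _ hκ₀ hκ₁
      (S.estimate_mem 0 x) (hint 0 _) (hint 1 _) (fun y => hs₀ _) (fun y => hs₁ _)

end BitSystem

theorem exp_mul_le_of_mem_Icc {s : ℝ} (hs : s ∈ Set.Icc 0 1) (l : ℝ) :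
    exp (l * s) ≤ 1 + (exp l - 1) * s := by
  have h := convexOn_exp.2 (Set.mem_univ 0) (Set.mem_univ l) (sub_nonneg.2 hs.2) hs.1 (by ring)
  simp only [smul_eq_mul, mul_zero, zero_add, Real.exp_zero] at h
  rw [mul_comm]
  linarith

theorem admissible_exp_mul {s : ℝ} (hs : s ∈ Set.Icc 0 1) (l₀ l₁ : ℝ) :
    Admissible (exp l₀ - 1) (min (1 - exp (-l₁)) (19 / 21)) (exp (l₀ * s)) (exp (-l₁ * s)) :=
  ⟨s, hs, exp_mul_le_of_mem_Icc hs l₀, (exp_mul_le_of_mem_Icc hs (-l₁)).trans (by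
    linarith [mul_le_mul_of_nonneg_right (min_le_left (1 - exp (-l₁)) (19 / 21)) hs.1])⟩

namespace BitSystem

variable {T : ℕ} {X E : Type*} [MeasurableSpace X] [NormedAddCommGroup E] [InnerProductSpace ℝ E]
  [FiniteDimensional ℝ E] [MeasurableSpace E]

/-- The mean of `φ` at the final state of the system started at `x`, for the bit value `u`. -/
noncomputable def meanOutput (S : BitSystem T X E) (φ : X → ℝ) (u : Fin 2) (x : X) : ℝ :=
  ∫ ε, φ (chain (S.step u) x ε (Fin.last T)) ∂Measure.pi fun _ => stdGaussian E

/-- The mean total cost of the system started at `x`, for the bit value `u`. -/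
noncomputable def meanCost (S : BitSystem T X E) (u : Fin 2) (x : X) : ℝ :=
  ∫ ε, ∑ t, S.cost u t (chain (S.step u) x ε t.castSucc) ∂Measure.pi fun _ => stdGaussian E

theorem meanOutput_swap (S : BitSystem T X E) (φ : X → ℝ) (u : Fin 2) (x : X) :
    S.swap.meanOutput φ u x = S.meanOutput φ (1 - u) x := rfl

theorem meanCost_swap (S : BitSystem T X E) (u : Fin 2) (x : X) :
    S.swap.meanCost u x = S.meanCost (1 - u) x := by
  simp only [meanCost, cost_swap]
  rfl

variable [BorelSpace E] (S : BitSystem T X E)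

theorem integrable_comp_chain {f : X → ℝ} (hf : Measurable f) {a b : ℝ}
    (hab : ∀ x, f x ∈ Set.Icc a b) (u : Fin 2) (x : X) (t : Fin (T + 1)) :
    Integrable (fun ε => f (chain (S.step u) x ε t)) (Measure.pi fun _ => stdGaussian E) :=
  .of_mem_Icc a b
    (hf.comp ((measurable_chain (S.measurable_step u) t).comp measurable_prodMk_left)).aemeasurable
    (ae_of_all _ fun _ => hab _)

theorem integrable_meanCost (μ : Measure X) [IsFiniteMeasure μ] (u : Fin 2) :
    Integrable (S.meanCost u) μ := by
  have h : S.meanCost u = -chainValue (stdGaussian E) (S.step u) (S.cost u) 0 := by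
    ext x
    simp [meanCost, chainValue, chainReward, integral_neg]
  exact h ▸ (Integrable.of_bound (measurable_chainValue (S.measurable_step u) (S.measurable_cost u)
    measurable_const).aestronglyMeasurable _ (ae_of_all _ fun x =>
      abs_chainValue_le (C := 0) (fun _ => abs_zero.le) (S.abs_cost_le u) x)).neg

variable {φ : X → ℝ} (hφ : Measurable φ) (hφ' : ∀ x, φ x ∈ Set.Icc 0 1)

section
include hφ hφ'

theorem meanOutput_mem_Icc (u : Fin 2) (x : X) : S.meanOutput φ u x ∈ Set.Icc 0 1 :=
  (convex_Icc 0 1).integral_mem isClosed_Icc (ae_of_all _ fun _ => hφ' _)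
    (S.integrable_comp_chain hφ hφ' u x _)

theorem integrable_meanOutput (μ : Measure X) [IsFiniteMeasure μ] (u : Fin 2) :
    Integrable (S.meanOutput φ u) μ := by
  have h : StronglyMeasurable (Function.uncurry fun x ε => φ (chain (S.step u) x ε (Fin.last T))) :=
    (hφ.comp (measurable_chain (S.measurable_step u) _)).stronglyMeasurable
  exact .of_mem_Icc 0 1 h.integral_prod_right.measurable.aemeasurable
    (ae_of_all _ (S.meanOutput_mem_Icc hφ hφ' u))

theorem meanOutput_one_sub (u : Fin 2) (x : X) :
    S.meanOutput (fun y => 1 - φ y) u x = 1 - S.meanOutput φ u x := by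
  rw [meanOutput, meanOutput, integral_sub (integrable_const 1)
    (S.integrable_comp_chain hφ hφ' u x _), integral_const, probReal_univ, one_smul]

theorem chainValue_const_mul (u : Fin 2) (l : ℝ) (x : X) :
    chainValue (stdGaussian E) (S.step u) (S.cost u) (fun y => l * φ y) x =
      l * S.meanOutput φ u x - S.meanCost u x := by
  rw [chainValue, meanOutput, meanCost, ← integral_const_mul, ← integral_sub]
  · rfl
  · exact (S.integrable_comp_chain hφ hφ' u x _).const_mul l
  · exact integrable_finsetSum _ fun t _ =>
      S.integrable_comp_chain (S.measurable_cost u t) (S.cost_mem_Icc u t) u x _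

theorem meanOutput_sub_le_of_le {l₀ l₁ : ℝ} (hl₀ : 0 < l₀) (hl₁ : 0 < l₁)
    (hl : l₀ ≤ log (21 / 2)) (x : X) :
    S.meanOutput φ 0 x - S.meanOutput φ 1 x ≤
      S.meanCost 0 x / l₀ + S.meanCost 1 x / l₁ + (l₀ + l₁) / 8 := by
  have hκ₀ : exp l₀ - 1 ∈ Set.Ioc 0 (19 / 2) := by
    rw [Real.le_log_iff_exp_le (by norm_num)] at hl
    exact ⟨sub_pos.2 (Real.one_lt_exp_iff.2 hl₀), by linarith⟩
  have hκ₁ : min (1 - exp (-l₁)) (19 / 21) ∈ Set.Ioc 0 (19 / 21) :=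
    ⟨lt_min (sub_pos.2 (Real.exp_lt_one_iff.2 (neg_lt_zero.2 hl₁))) (by norm_num), min_le_right _ _⟩
  have hbdd (u : Fin 2) (y : X) : |![l₀, -l₁] u * φ y| ≤ max l₀ l₁ := by
    rw [abs_mul, abs_of_nonneg (hφ' y).1]
    refine (mul_le_of_le_one_right (abs_nonneg _) (hφ' y).2).trans ?_
    fin_cases u <;> simp [abs_of_pos hl₀, abs_of_pos hl₁]
  have hadm := S.admissible_chainValue hκ₀ hκ₁ (fun u => hφ.const_mul (![l₀, -l₁] u)) hbdd
    (fun y => admissible_exp_mul (hφ' y) l₀ l₁) x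
  simp only [chainValue_const_mul S hφ hφ'] at hadm
  exact Admissible.sub_le hl₀ hl₁ (by simpa using hadm)

theorem meanOutput_sub_le {l₀ l₁ : ℝ} (hl₀ : 0 < l₀) (hl₁ : 0 < l₁)
    (hl : min l₀ l₁ ≤ log (21 / 2)) (x : X) :
    S.meanOutput φ 0 x - S.meanOutput φ 1 x ≤
      S.meanCost 0 x / l₀ + S.meanCost 1 x / l₁ + (l₀ + l₁) / 8 := by
  rcases min_le_iff.1 hl with hl | hl
  · exact S.meanOutput_sub_le_of_le hφ hφ' hl₀ hl₁ hl x
  · have h := S.swap.meanOutput_sub_le_of_le (φ := fun y => 1 - φ y) (by fun_prop)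
      (fun y => ⟨sub_nonneg.2 (hφ' y).2, sub_le_self _ (hφ' y).1⟩) hl₁ hl₀ hl x
    simp only [meanOutput_swap, meanCost_swap, meanOutput_one_sub S hφ hφ', sub_zero, sub_self] at h
    linarith

theorem integral_meanOutput_sub_le (μ : Measure X) [IsProbabilityMeasure μ] :
    ∫ x, S.meanOutput φ 0 x ∂μ - ∫ x, S.meanOutput φ 1 x ∂μ ≤
      √((∫ x, S.meanCost 0 x ∂μ) / 2) + √((∫ x, S.meanCost 1 x ∂μ) / 2) := by
  refine sub_le_sqrt_add_sqrt ?_ fun l₀ l₁ hl₀ hl₁ hl => ?_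
  · have h (u : Fin 2) : ∫ x, S.meanOutput φ u x ∂μ ∈ Set.Icc 0 1 :=
      convex_Icc 0 1 |>.integral_mem isClosed_Icc (ae_of_all _ (S.meanOutput_mem_Icc hφ hφ' u))
        (S.integrable_meanOutput hφ hφ' μ u)
    linarith [(h 0).2, (h 1).1]
  · have hO (u : Fin 2) := S.integrable_meanOutput hφ hφ' μ u
    have hK₀ := (S.integrable_meanCost μ 0).div_const l₀
    have hK₁ := (S.integrable_meanCost μ 1).div_const l₁
    have hK : Integrable (fun x => S.meanCost 0 x / l₀ + S.meanCost 1 x / l₁) μ := hK₀.add hK₁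
    calc ∫ x, S.meanOutput φ 0 x ∂μ - ∫ x, S.meanOutput φ 1 x ∂μ
      _ = ∫ x, S.meanOutput φ 0 x - S.meanOutput φ 1 x ∂μ := (integral_sub (hO 0) (hO 1)).symm
      _ ≤ ∫ x, S.meanCost 0 x / l₀ + S.meanCost 1 x / l₁ + (l₀ + l₁) / 8 ∂μ :=
          integral_mono ((hO 0).sub (hO 1)) (hK.add (integrable_const _))
            (S.meanOutput_sub_le hφ hφ' hl₀ hl₁ hl)
      _ = _ := by
          rw [integral_add hK (integrable_const _), integral_add hK₀ hK₁, integral_div,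
            integral_div, integral_const, probReal_univ, one_smul]

theorem integral_chain_sub_le {Θ : Type*} [MeasurableSpace Θ] (μ : Measure Θ)
    [IsProbabilityMeasure μ] {x₀ : Θ → X} (hx₀ : Measurable x₀) :
    let π := μ.prod (Measure.pi fun _ : Fin T => stdGaussian E)
    ∫ p, φ (chain (S.step 0) (x₀ p.1) p.2 (Fin.last T)) ∂π -
        ∫ p, φ (chain (S.step 1) (x₀ p.1) p.2 (Fin.last T)) ∂π ≤
      √((∑ t, ∫ p, S.cost 0 t (chain (S.step 0) (x₀ p.1) p.2 t.castSucc) ∂π) / 2) +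
        √((∑ t, ∫ p, S.cost 1 t (chain (S.step 1) (x₀ p.1) p.2 t.castSucc) ∂π) / 2) := by
  intro π
  have hchain (u : Fin 2) (t : Fin (T + 1)) :
      Measurable fun p : Θ × (Fin T → E) => chain (S.step u) (x₀ p.1) p.2 t :=
    (measurable_chain (S.measurable_step u) t).comp
      ((hx₀.comp measurable_fst).prodMk measurable_snd)
  have hO (u : Fin 2) : ∫ p, φ (chain (S.step u) (x₀ p.1) p.2 (Fin.last T)) ∂π =
      ∫ x, S.meanOutput φ u x ∂μ.map x₀ := by
    rw [integral_map hx₀.aemeasurable (S.integrable_meanOutput hφ hφ' _ u).1, integral_prod]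
    · rfl
    · exact .of_mem_Icc 0 1 (hφ.comp (hchain u _)).aemeasurable (ae_of_all _ fun _ => hφ' _)
  have hcost (u : Fin 2) (t : Fin T) :
      Integrable (fun p => S.cost u t (chain (S.step u) (x₀ p.1) p.2 t.castSucc)) π :=
    .of_mem_Icc 0 (log (21 / 2)) ((S.measurable_cost u t).comp (hchain u _)).aemeasurable
      (ae_of_all _ fun _ => S.cost_mem_Icc ..)
  have hK (u : Fin 2) : ∑ t, ∫ p, S.cost u t (chain (S.step u) (x₀ p.1) p.2 t.castSucc) ∂π =
      ∫ x, S.meanCost u x ∂μ.map x₀ := by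
    rw [integral_map hx₀.aemeasurable (S.integrable_meanCost _ u).1,
      ← integral_finsetSum _ fun t _ => hcost u t,
      integral_prod _ (integrable_finsetSum _ fun t _ => hcost u t)]
    rfl
  have := Measure.isProbabilityMeasure_map (μ := μ) hx₀.aemeasurable
  rw [hO, hO, hK, hK]
  exact S.integral_meanOutput_sub_le hφ hφ' (μ.map x₀)

end

theorem integral_chain_sub_le_of_abs_le {Θ : Type*} [MeasurableSpace Θ] {h : X → ℝ}
    (hh : Measurable h) {C : ℝ} (hC : ∀ x, |h x| ≤ C) (μ : Measure Θ) [IsProbabilityMeasure μ]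
    {x₀ : Θ → X} (hx₀ : Measurable x₀) :
    let π := μ.prod (Measure.pi fun _ : Fin T => stdGaussian E)
    ∫ p, h (chain (S.step 0) (x₀ p.1) p.2 (Fin.last T)) ∂π -
        ∫ p, h (chain (S.step 1) (x₀ p.1) p.2 (Fin.last T)) ∂π ≤
      √2 * C * (√(∑ t, ∫ p, S.cost 0 t (chain (S.step 0) (x₀ p.1) p.2 t.castSucc) ∂π) +
        √(∑ t, ∫ p, S.cost 1 t (chain (S.step 1) (x₀ p.1) p.2 t.castSucc) ∂π)) := by
  intro π
  obtain ⟨θ⟩ := nonempty_of_isProbabilityMeasure μ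
  rcases ((abs_nonneg _).trans (hC (x₀ θ))).eq_or_lt with rfl | hpos
  · simp [abs_nonpos_iff.1 (hC _)]
  have hφ (x : X) : (h x + C) / (2 * C) ∈ Set.Icc 0 1 := by
    obtain ⟨hl, hu⟩ := abs_le.1 (hC x)
    exact ⟨div_nonneg (by linarith) (by linarith), (div_le_one (by linarith)).2 (by linarith)⟩
  have hint (u : Fin 2) : ∫ p, (h (chain (S.step u) (x₀ p.1) p.2 (Fin.last T)) + C) / (2 * C) ∂π =
      (∫ p, h (chain (S.step u) (x₀ p.1) p.2 (Fin.last T)) ∂π + C) / (2 * C) := by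
    have hmeas : Measurable fun p : Θ × (Fin T → E) =>
        h (chain (S.step u) (x₀ p.1) p.2 (Fin.last T)) :=
      hh.comp ((measurable_chain (S.measurable_step u) _).comp
        ((hx₀.comp measurable_fst).prodMk measurable_snd))
    rw [integral_div, integral_add (.of_bound hmeas.aestronglyMeasurable C (ae_of_all _ fun _ =>
      hC _)) (integrable_const C), integral_const, probReal_univ, one_smul]
  have hmain := S.integral_chain_sub_le ((hh.add_const C).div_const (2 * C)) hφ μ hx₀
  simp only at hmain
  rw [hint, hint, ← sub_div, div_le_iff₀ (by linarith), Real.sqrt_div' _ zero_le_two,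
    Real.sqrt_div' _ zero_le_two, ← add_div, add_sub_add_right_eq_sub] at hmain
  refine hmain.trans_eq ?_
  rw [div_mul_eq_mul_div, div_eq_iff (by positivity)]
  linear_combination (-C * (√(∑ t, ∫ p, S.cost 0 t (chain (S.step 0) (x₀ p.1) p.2 t.castSucc) ∂π) +
    √(∑ t, ∫ p, S.cost 1 t (chain (S.step 1) (x₀ p.1) p.2 t.castSucc) ∂π))) *
      Real.mul_self_sqrt zero_le_two

end BitSystem

/-! ### Measurability of SGLD -/

theorem measurable_gradient_uncurry {E Z : Type*} [NormedAddCommGroup E] [InnerProductSpace ℝ E]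
    [FiniteDimensional ℝ E] [MeasurableSpace E] [BorelSpace E] [MeasurableSpace Z] {f : E → Z → ℝ}
    (hf : Measurable (Function.uncurry f)) (hf' : ∀ z, Differentiable ℝ fun x => f x z) :
    Measurable fun p : E × Z => gradient (fun x => f x p.2) p.1 := by
  have hderiv (y : E) : Measurable fun p : E × Z => fderiv ℝ (fun x => f x p.2) p.1 y := by
    refine measurable_of_tendsto_metrizable (f := fun (n : ℕ) (p : E × Z) =>
      (n : ℝ) • (f (p.1 + (n : ℝ)⁻¹ • y) p.2 - f p.1 p.2)) (fun n => ?_)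
      (tendsto_pi_nhds.2 fun p => (((hf' p.2) p.1).hasFDerivAt.lim_real y).comp
        tendsto_natCast_atTop_atTop)
    exact ((hf.comp ((measurable_fst.add_const _).prodMk measurable_snd)).sub hf).const_smul (n : ℝ)
  let b := stdOrthonormalBasis ℝ E
  have hcoord (p : E × Z) : gradient (fun x => f x p.2) p.1 =
      ∑ i, fderiv ℝ (fun x => f x p.2) p.1 (b i) • b i := by
    simp only [← inner_gradient_left, real_inner_comm (b _), b.sum_repr']
  simp only [hcoord]
  exact Finset.measurable_sum _ fun i _ => (hderiv (b i)).smul_const _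

variable {N d T : ℕ} {Z : Type*} {loss : Param d → Z → ℝ}

theorem gradient_batchRisk (hd : ∀ z, Differentiable ℝ fun w => loss w z) (S : Fin N → Z)
    (B : Finset (Fin N)) (w : Param d) :
    gradient (batchRisk loss S B) w =
      (1 / (B.card : ℝ)) • ∑ i ∈ B, gradient (fun θ => loss θ (S i)) w := by
  refine HasGradientAt.gradient ?_
  rw [hasGradientAt_iff_hasFDerivAt, map_smul, map_sum]
  refine .const_mul (.fun_sum fun i _ => ?_) _
  exact toDual_gradient (𝕜 := ℝ) (f := fun θ => loss θ (S i)) ▸ ((hd (S i)) w).hasFDerivAt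

/-- The update number `t` of SGLD without its noise. -/
noncomputable def noiselessUpdate (loss : Param d → Z → ℝ) (η : Fin T → ℝ) (S : Fin N → Z)
    (v : Fin T → Finset (Fin N)) (t : Fin T) (θ : Param d) : Param d :=
  θ - η t • gradient (batchRisk loss S (v t)) θ

theorem noiselessUpdate_congr {S S' : Fin N → Z} {v : Fin T → Finset (Fin N)} {t : Fin T}
    (h : ∀ i ∈ v t, S i = S' i) (η : Fin T → ℝ) :
    noiselessUpdate loss η S v t = noiselessUpdate loss η S' v t := by
  have hrisk : batchRisk loss S (v t) = batchRisk loss S' (v t) := by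
    ext w
    rw [batchRisk, batchRisk, Finset.sum_congr rfl fun i hi => by rw [h i hi]]
  unfold noiselessUpdate
  rw [hrisk]

theorem noiselessUpdate_sub (hd : ∀ z, Differentiable ℝ fun w => loss w z) {S S' : Fin N → Z}
    {v : Fin T → Finset (Fin N)} {t : Fin T} {j : Fin N} (hj : j ∈ v t)
    (h : ∀ i ≠ j, S i = S' i) (η : Fin T → ℝ) (w : Param d) :
    noiselessUpdate loss η S v t w - noiselessUpdate loss η S' v t w =
      (η t / ((v t).card : ℝ)) •
        (gradient (fun θ => loss θ (S' j)) w - gradient (fun θ => loss θ (S j)) w) := by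
  have hrest : ∑ i ∈ (v t).erase j, gradient (fun θ => loss θ (S i)) w =
      ∑ i ∈ (v t).erase j, gradient (fun θ => loss θ (S' i)) w :=
    Finset.sum_congr rfl fun i hi => by rw [h i (Finset.ne_of_mem_erase hi)]
  rw [noiselessUpdate, noiselessUpdate, gradient_batchRisk hd, gradient_batchRisk hd,
    ← Finset.add_sum_erase _ _ hj, ← Finset.add_sum_erase _ _ hj, hrest]
  module

variable [MeasurableSpace Z]

theorem measurable_noiselessUpdate (hm : Measurable (Function.uncurry loss))
    (hd : ∀ z, Differentiable ℝ fun w => loss w z) (η : Fin T → ℝ)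
    (v : Fin T → Finset (Fin N)) (t : Fin T) :
    Measurable fun p : (Fin N → Z) × Param d => noiselessUpdate loss η p.1 v t p.2 := by
  simp only [noiselessUpdate, gradient_batchRisk hd]
  have hgrad (i : Fin N) :
      Measurable fun p : (Fin N → Z) × Param d => gradient (fun θ => loss θ (p.1 i)) p.2 :=
    (measurable_gradient_uncurry hm hd).comp
      (measurable_snd.prodMk ((measurable_pi_apply i).comp measurable_fst))
  fun_prop

/-- The space of the super-samples, the bits and the batches. -/
abbrev DataSpace (N T : ℕ) (Z : Type*) : Type _ :=
  SuperSample N Z × (Fin N → Fin 2) × (Fin T → Finset (Fin N))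

/-- The space of the initializations and the noise. -/
abbrev NoiseSpace (d T : ℕ) : Type := Param d × (Fin T → Param d)

/-- The law of the initialization and the noise. -/
noncomputable abbrev noiseLaw (T : ℕ) (P0 : Measure (Param d)) : Measure (NoiseSpace d T) :=
  P0.prod (Measure.pi fun _ => stdGaussian (Param d))

/-- The iterates of SGLD as a function of all the randomness. -/
noncomputable def run (loss : Param d → Z → ℝ) (η σ : Fin T → ℝ) (x : DataSpace N T Z)
    (ξ : NoiseSpace d T) : Fin (T + 1) → Param d :=
  iterates loss η σ (dataset x.1 x.2.1) x.2.2 ξ.1 ξ.2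

/-- The trajectory of SGLD that precedes the update `t`, as a function of all the randomness. -/
noncomputable def history (loss : Param d → Z → ℝ) (η σ : Fin T → ℝ) (t : Fin T)
    (x : DataSpace N T Z) (ξ : NoiseSpace d T) : History d T t :=
  fun r => run loss η σ x ξ r

theorem measurable_of_discrete {α β : Type*} [MeasurableSpace α] [MeasurableSpace β]
    {f : DataSpace N T Z × α → β}
    (hf : ∀ u v, Measurable fun p : SuperSample N Z × α => f ((p.1, u, v), p.2)) :
    Measurable f := by
  have h : Measurable fun q : ((Fin N → Fin 2) × (Fin T → Finset (Fin N))) ×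
      (SuperSample N Z × α) => f ((q.2.1, q.1), q.2.2) :=
    measurable_from_prod_countable_right fun c => hf c.1 c.2
  have hswap : Measurable fun p : DataSpace N T Z × α => (p.1.2, (p.1.1, p.2)) := by fun_prop
  exact h.comp hswap

theorem measurable_run (hm : Measurable (Function.uncurry loss))
    (hd : ∀ z, Differentiable ℝ fun w => loss w z) (η σ : Fin T → ℝ) :
    Measurable fun p : DataSpace N T Z × NoiseSpace d T => run loss η σ p.1 p.2 := by
  refine measurable_of_discrete fun u v => measurable_pi_lambda _ fun i => ?_
  induction i using Fin.induction with
  | zero => exact measurable_fst.comp measurable_snd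
  | succ t ih =>
    have hdata : Measurable fun s : SuperSample N Z => dataset s u :=
      measurable_pi_lambda _ fun _ => measurable_pi_apply _
    exact ((measurable_noiselessUpdate hm hd η v t).comp
      ((hdata.comp measurable_fst).prodMk ih)).add
      (((measurable_pi_apply t).comp (measurable_snd.comp measurable_snd)).const_smul (σ t))

theorem measurable_history (hm : Measurable (Function.uncurry loss))
    (hd : ∀ z, Differentiable ℝ fun w => loss w z) (η σ : Fin T → ℝ) (t : Fin T) :
    Measurable fun p : DataSpace N T Z × NoiseSpace d T => history loss η σ t p.1 p.2 :=
  measurable_pi_lambda _ fun r => (measurable_pi_apply (r : Fin (T + 1))).comp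
    (measurable_run hm hd η σ)

theorem measurable_minTerm (hm : Measurable (Function.uncurry loss))
    (hd : ∀ z, Differentiable ℝ fun w => loss w z) (η σ : Fin T → ℝ) {est : Estimator N d T Z}
    (hest : ∀ t j, Measurable (est t j)) (t : Fin T) (j : Fin N) :
    Measurable fun p : DataSpace N T Z × History d T t =>
      minTerm loss η σ est t j p.1.1 p.1.2.1 p.1.2.2 p.2 := by
  refine measurable_of_discrete fun u v => ?_
  have hgrad (c : Fin 2) : Measurable fun p : SuperSample N Z × History d T t =>
      gradient (fun θ => loss θ (p.1 (j, c))) p.2.last :=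
    (measurable_gradient_uncurry hm hd).comp (.prodMk
      ((measurable_pi_apply (⟨t.castSucc, Set.self_mem_Iic⟩ : Set.Iic t.castSucc)).comp
        measurable_snd)
      ((measurable_pi_apply (j, c)).comp measurable_fst))
  have hsignal : Measurable fun p : SuperSample N Z × History d T t =>
      signal (η t) (σ t) (v t).card (incoherence loss p.1 j p.2.last) := by
    unfold signal incoherence
    exact ((((hgrad 0).sub (hgrad 1)).norm.pow_const 2).const_mul _).div_const _
  have hest' : Measurable fun p : SuperSample N Z × History d T t =>
      est t j (p.2, p.1, fun i => u i, v) :=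
    (hest t j).comp (measurable_snd.prodMk (measurable_fst.prodMk measurable_const))
  exact ((measurable_fTerm (u j)).comp (hsignal.prodMk hest')).min
    ((measurable_gTerm (u j)).comp (hsignal.prodMk hest'))

/-! ### The pair gap of one index -/

theorem chain_update_apply {T : ℕ} {E F : Type*} (step : Fin T → E → F → E) (x : E) (ε : Fin T → F)
    {k r : Fin (T + 1)} (hr : r ≤ k) :
    chain (fun t w e => Function.update w t.succ (step t (w t.castSucc) e)) (fun _ => x) ε k r =
      chain step x ε r := by
  induction k using Fin.induction generalizing r with
  | zero => rw [Fin.le_zero_iff.1 hr]; rfl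
  | succ k ih =>
    rcases hr.eq_or_lt with rfl | hlt
    · exact (Function.update_self ..).trans (congrArg (step k · (ε k)) (ih le_rfl))
    · exact (Function.update_of_ne hlt.ne ..).trans (ih (Fin.le_castSucc_iff.2 hlt))

theorem ofReal_sqrt_sum_integral_le {X ι : Type*} [Fintype ι] [MeasurableSpace X] {μ : Measure X}
    {s : Finset ι} {f g : ι → X → ℝ} (hf : ∀ i x, 0 ≤ f i x) (hfs : ∀ i ∉ s, ∀ x, f i x = 0)
    (hfg : ∀ i ∈ s, ∀ x, f i x ≤ g i x) :
    ENNReal.ofReal √(∑ i, ∫ x, f i x ∂μ) ≤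
      (∑ i ∈ s, ∫⁻ x, ENNReal.ofReal (g i x) ∂μ) ^ (1 / 2 : ℝ) := by
  have hint (i : ι) : 0 ≤ ∫ x, f i x ∂μ := integral_nonneg (hf i)
  rw [Real.sqrt_eq_rpow, ← ENNReal.ofReal_rpow_of_nonneg (Finset.sum_nonneg fun i _ => hint i)
    (by norm_num), ← Finset.sum_subset s.subset_univ fun i _ hi => by simp [hfs i hi],
    ENNReal.ofReal_sum_of_nonneg fun i _ => hint i]
  gcongr with i hi
  calc ENNReal.ofReal (∫ x, f i x ∂μ)
    _ ≤ ‖∫ x, f i x ∂μ‖ₑ := Real.ofReal_le_enorm _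
    _ ≤ ∫⁻ x, ‖f i x‖ₑ ∂μ := enorm_integral_le_lintegral_enorm _
    _ ≤ ∫⁻ x, ENNReal.ofReal (g i x) ∂μ := lintegral_mono fun x => by
      rw [Real.enorm_of_nonneg (hf i x)]
      exact ENNReal.ofReal_le_ofReal (hfg i hi x)

variable {N d T : ℕ} {Z : Type*} [MeasurableSpace Z]

/-- The data with the bit number `j` replaced. -/
def setBit (j : Fin N) (c : Fin 2) (x : DataSpace N T Z) : DataSpace N T Z :=
  (x.1, Function.update x.2.1 j c, x.2.2)

/-- The excess loss of SGLD on the point of the pair number `j` that is not in the dataset. -/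
def pairGap (loss : Param d → Z → ℝ) (j : Fin N) (x : DataSpace N T Z) (w : Param d) : ℝ :=
  loss w (x.1 (j, 1 - x.2.1 j)) - loss w (x.1 (j, x.2.1 j))

/-- The mean of `pairGap` over the noise. -/
noncomputable def meanGap (loss : Param d → Z → ℝ) (η σ : Fin T → ℝ) (P0 : Measure (Param d))
    (j : Fin N) (x : DataSpace N T Z) : ℝ :=
  ∫ ξ, pairGap loss j x (run loss η σ x ξ (Fin.last T)) ∂noiseLaw T P0

/-- The information bound of the pair number `j`, given the data. -/
noncomputable def infoBound (loss : Param d → Z → ℝ) (η σ : Fin T → ℝ) (est : Estimator N d T Z)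
    (P0 : Measure (Param d)) (j : Fin N) (x : DataSpace N T Z) : ℝ≥0∞ :=
  (∑ t with j ∈ x.2.2 t, ∫⁻ ξ, ENNReal.ofReal (minTerm loss η σ est t j x.1 x.2.1 x.2.2
    (history loss η σ t x ξ)) ∂noiseLaw T P0) ^ (1 / 2 : ℝ)

variable {loss : Param d → Z → ℝ} {a b : ℝ} (hm : Measurable (Function.uncurry loss))
  (hd : ∀ z, Differentiable ℝ fun w => loss w z) (η : Fin T → ℝ) {σ : Fin T → ℝ}
  {est : Estimator N d T Z} (hest : ∀ t j, Measurable (est t j))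
  (hest' : ∀ t j x, est t j x ∈ Set.Icc (0 : ℝ) 1) (j : Fin N) (x : DataSpace N T Z)

/-- SGLD as a function of the bit number `j`, the other data being fixed. The state is the whole
trajectory, in which the update `t` writes the entry `t + 1`; the drift is divided by `σ t`, so that
the noise is standard. -/
@[simps drift]
noncomputable def bitSystem (σ : Fin T → ℝ) :
    BitSystem T (Fin (T + 1) → Param d) (Param d) where
  transition t w y := Function.update w t.succ (σ t • y)
  drift c t w := (σ t)⁻¹ •
    noiselessUpdate loss η (dataset x.1 (setBit j c x).2.1) x.2.2 t (w t.castSucc)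
  estimate t w := est t j (fun r => w r, x.1, fun i => x.2.1 i, x.2.2)
  measurable_transition t := measurable_update'.comp
    (measurable_fst.prodMk (measurable_snd.const_smul (σ t)))
  measurable_drift _ t := ((measurable_noiselessUpdate hm hd η x.2.2 t).comp
    (measurable_const.prodMk (measurable_pi_apply t.castSucc))).const_smul (σ t)⁻¹
  measurable_estimate t := (hest t j).comp
    ((measurable_pi_lambda _ fun _ => measurable_pi_apply _).prodMk measurable_const)
  estimate_mem t _ := hest' t j _

include hm hd hest hest'

theorem chain_bitSystem (hσ : ∀ t, σ t ≠ 0) (c : Fin 2) (ξ : NoiseSpace d T) {k r : Fin (T + 1)}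
    (hr : r ≤ k) :
    chain ((bitSystem hm hd η hest hest' j x σ).step c) (fun _ => ξ.1) ξ.2 k r =
      run loss η σ (setBit j c x) ξ r := by
  have hstep : (bitSystem hm hd η hest hest' j x σ).step c = fun t w e =>
      Function.update w t.succ (noiselessUpdate loss η (dataset x.1 (setBit j c x).2.1) x.2.2 t
        (w t.castSucc) + σ t • e) := by
    funext t w e
    refine congrArg (Function.update w t.succ) ?_
    rw [bitSystem_drift, smul_add, smul_inv_smul₀ (hσ t)]
  rw [hstep]
  exact chain_update_apply (fun t θ e => noiselessUpdate loss η (dataset x.1 (setBit j c x).2.1)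
    x.2.2 t θ + σ t • e) ξ.1 ξ.2 hr

theorem cost_bitSystem_of_notMem (c : Fin 2) {t : Fin T} (hj : j ∉ x.2.2 t)
    (w : Fin (T + 1) → Param d) : (bitSystem hm hd η hest hest' j x σ).cost c t w = 0 := by
  have hdrift : noiselessUpdate loss η (dataset x.1 (setBit j 1 x).2.1) x.2.2 t =
      noiselessUpdate loss η (dataset x.1 (setBit j 0 x).2.1) x.2.2 t :=
    noiselessUpdate_congr (fun i hi => by
      simp [dataset, setBit, Function.update_of_ne (ne_of_mem_of_not_mem hi hj)]) η
  refine le_antisymm ((min_le_left _ _).trans ((min_le_left _ _).trans_eq ?_))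
    (BitSystem.cost_mem_Icc ..).1
  simp [fTerm, hdrift]

theorem cost_bitSystem_le_minTerm (c : Fin 2) {t : Fin T} (hj : j ∈ x.2.2 t)
    (w : Fin (T + 1) → Param d) :
    (bitSystem hm hd η hest hest' j x σ).cost c t w ≤ minTerm loss η σ est t j x.1
      (setBit j c x).2.1 x.2.2 fun r => w r := by
  have hA : ‖(bitSystem hm hd η hest hest' j x σ).drift 1 t w -
      (bitSystem hm hd η hest hest' j x σ).drift 0 t w‖ ^ 2 / 2 =
      signal (η t) (σ t) (x.2.2 t).card (incoherence loss x.1 j (w t.castSucc)) := by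
    simp only [bitSystem_drift]
    rw [← smul_sub, noiselessUpdate_sub hd hj fun i hi => by simp [dataset, setBit, hi]]
    simp only [norm_smul, mul_pow, norm_inv, norm_div, Real.norm_eq_abs, inv_pow, div_pow, sq_abs,
      signal, incoherence, dataset, setBit, Function.update_self]
    ring
  have hbits : (fun i : {i // i ≠ j} => (setBit j c x).2.1 i) = fun i : {i // i ≠ j} => x.2.1 i :=
    funext fun i => Function.update_of_ne i.2 _ _
  refine (min_le_left _ _).trans_eq ?_
  rw [hA, minTerm, hbits]
  simp only [setBit, Function.update_self]
  rfl

theorem ofReal_sqrt_sum_cost_le (hσ : ∀ t, σ t ≠ 0) (P0 : Measure (Param d)) (c : Fin 2) :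
    ENNReal.ofReal √(∑ t, ∫ ξ, (bitSystem hm hd η hest hest' j x σ).cost c t
      (chain ((bitSystem hm hd η hest hest' j x σ).step c) (fun _ => ξ.1) ξ.2 t.castSucc)
        ∂noiseLaw T P0) ≤
      infoBound loss η σ est P0 j (setBit j c x) := by
  refine ofReal_sqrt_sum_integral_le (fun t ξ => (BitSystem.cost_mem_Icc ..).1)
    (fun t ht ξ => ?_) fun t ht ξ => ?_
  · exact cost_bitSystem_of_notMem hm hd η hest hest' j x c
      (fun hj => ht (Finset.mem_filter.2 ⟨Finset.mem_univ t, hj⟩)) _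
  · have hj := (Finset.mem_filter.1 ht).2
    refine (cost_bitSystem_le_minTerm hm hd η hest hest' j x c hj _).trans_eq
      (congrArg (minTerm loss η σ est t j _ _ _) (funext fun r => ?_))
    exact chain_bitSystem hm hd η hest hest' j x hσ c ξ r.2

theorem ofReal_meanGap_add_le (hab : ∀ w z, loss w z ∈ Set.Icc a b) (hσ : ∀ t, σ t ≠ 0)
    (P0 : Measure (Param d)) [IsProbabilityMeasure P0] :
    ENNReal.ofReal (meanGap loss η σ P0 j (setBit j 0 x) + meanGap loss η σ P0 j (setBit j 1 x)) ≤
      ENNReal.ofReal (√2 * (b - a)) * (infoBound loss η σ est P0 j (setBit j 0 x) +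
        infoBound loss η σ est P0 j (setBit j 1 x)) := by
  let S := bitSystem hm hd η hest hest' j x σ
  let h : (Fin (T + 1) → Param d) → ℝ := fun w =>
    loss (w (Fin.last T)) (x.1 (j, 1)) - loss (w (Fin.last T)) (x.1 (j, 0))
  have hloss (z : Z) : Measurable fun w : Fin (T + 1) → Param d => loss (w (Fin.last T)) z :=
    hm.of_uncurry_right.comp (measurable_pi_apply _)
  have hgap₀ : meanGap loss η σ P0 j (setBit j 0 x) =
      ∫ ξ, h (chain (S.step 0) (fun _ => ξ.1) ξ.2 (Fin.last T)) ∂noiseLaw T P0 := by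
    simp [meanGap, pairGap, h, S, chain_bitSystem hm hd η hest hest' j x hσ _ _ le_rfl, setBit]
  have hgap₁ : meanGap loss η σ P0 j (setBit j 1 x) =
      -∫ ξ, h (chain (S.step 1) (fun _ => ξ.1) ξ.2 (Fin.last T)) ∂noiseLaw T P0 := by
    rw [← integral_neg]
    simp [meanGap, pairGap, h, S, chain_bitSystem hm hd η hest hest' j x hσ _ _ le_rfl, setBit]
  have hC (w : Fin (T + 1) → Param d) : |h w| ≤ b - a :=
    Real.dist_le_of_mem_Icc (hab ..) (hab ..)
  have hmain := S.integral_chain_sub_le_of_abs_le ((hloss _).sub (hloss _)) hC P0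
    (measurable_pi_lambda (fun θ (_ : Fin (T + 1)) => θ) fun _ => measurable_id)
  have hba : 0 ≤ b - a := (abs_nonneg _).trans (hC 0)
  rw [hgap₀, hgap₁, ← sub_eq_add_neg]
  refine (ENNReal.ofReal_le_ofReal hmain).trans ?_
  rw [ENNReal.ofReal_mul (by positivity), ENNReal.ofReal_add (by positivity) (by positivity)]
  gcongr
  · exact ofReal_sqrt_sum_cost_le hm hd η hest hest' j x hσ P0 0
  · exact ofReal_sqrt_sum_cost_le hm hd η hest hest' j x hσ P0 1

end SGLD

/-! ### The conditional law of the history -/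

theorem condDistrib_ae_eq_map_of_hasLaw_prod {Ω B X Y : Type*} [MeasurableSpace Ω]
    [MeasurableSpace B] [MeasurableSpace X] [MeasurableSpace Y] [StandardBorelSpace Y] [Nonempty Y]
    {P : Measure Ω} [IsFiniteMeasure P] {μ : Measure B} [SFinite μ] {ν : Measure X}
    [IsProbabilityMeasure ν] {f : Ω → B} {ξ : Ω → X}
    (h : HasLaw (fun ω => (f ω, ξ ω)) (μ.prod ν) P) {g : B × X → Y} (hg : Measurable g) :
    ∀ᵐ ω ∂P, condDistrib (fun ω => g (f ω, ξ ω)) f P (f ω) = ν.map fun x => g (f ω, x) := by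
  have hf : HasLaw f μ P := measurePreserving_fst.fun_comp_hasLaw h
  have hgraph : Measurable fun p : B × X => (p.1, g p) := measurable_fst.prodMk hg
  let κ : Kernel B Y := (Kernel.id ×ₖ Kernel.const B ν).map g
  have hκ (c : B) : κ c = ν.map fun x => g (c, x) := by
    rw [Kernel.map_apply _ hg, Kernel.prod_apply, Kernel.id_apply, Kernel.const_apply,
      Measure.dirac_prod, Measure.map_map hg measurable_prodMk_left]
    rfl
  have hjoint : P.map (fun ω => (f ω, g (f ω, ξ ω))) = P.map f ⊗ₘ κ := by
    rw [hf.map_eq, ((hgraph.measurePreserving _).fun_comp_hasLaw h).map_eq]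
    ext s hs
    rw [Measure.map_apply hgraph hs, Measure.prod_apply (hgraph hs), Measure.compProd_apply hs]
    refine lintegral_congr fun c => ?_
    rw [hκ, Measure.map_apply (by fun_prop) (measurable_prodMk_left hs)]
    rfl
  filter_upwards [ae_of_ae_map hf.aemeasurable (condDistrib_ae_eq_of_measure_eq_compProd f
    (hg.comp_aemeasurable h.aemeasurable) hjoint)] with ω hω
  exact hω.trans (hκ (f ω))

theorem condDistrib_ae_eq_map_of_factorsThrough {Ω A B X Y : Type*} [MeasurableSpace Ω]
    [MeasurableSpace A] [MeasurableSpace B] [MeasurableSpace X] [MeasurableSpace Y]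
    [StandardBorelSpace Y] [Nonempty Y] {P : Measure Ω} [IsFiniteMeasure P] {μ : Measure A}
    [SFinite μ] {ν : Measure X} [IsProbabilityMeasure ν] {f : Ω → A} {ξ : Ω → X}
    (h : HasLaw (fun ω => (f ω, ξ ω)) (μ.prod ν) P) {g : A × X → Y} (hg : Measurable g)
    {y : A → B} (hy : Measurable y) {k : B → A} (hk : Measurable k)
    (hgk : ∀ c x, g (k (y c), x) = g (c, x)) :
    ∀ᵐ ω ∂P, condDistrib (fun ω => g (f ω, ξ ω)) (fun ω => y (f ω)) P (y (f ω)) =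
      ν.map fun x => g (f ω, x) := by
  have hlaw : HasLaw (fun ω => (y (f ω), ξ ω)) ((μ.map y).prod ν) P :=
    ((hy.measurePreserving μ).prod (.id ν)).fun_comp_hasLaw h
  simpa only [Function.comp_apply, Prod.map_apply, id_eq, hgk] using
    condDistrib_ae_eq_map_of_hasLaw_prod hlaw (hg.comp (hk.prodMap measurable_id))

namespace SGLD

variable {N d T : ℕ} {Z : Type*} {loss : Param d → Z → ℝ}

theorem run_congr (η σ : Fin T → ℝ) {s : SuperSample N Z} {u : Fin N → Fin 2}
    {v v' : Fin T → Finset (Fin N)} {ξ : NoiseSpace d T} {i : Fin (T + 1)}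
    (h : ∀ t : Fin T, t.castSucc < i → v t = v' t) :
    run loss η σ (s, u, v) ξ i = run loss η σ (s, u, v') ξ i := by
  induction i using Fin.induction with
  | zero => rfl
  | succ t ih =>
    specialize ih fun r hr => h r (hr.trans t.castSucc_lt_succ)
    simp only [run, iterates, Fin.induction_succ] at ih ⊢
    rw [ih, h t t.castSucc_lt_succ]

variable [MeasurableSpace Z]

variable {Ω : Type*} [MeasurableSpace Ω] {P : Measure Ω} [IsProbabilityMeasure P]
  {P0 : Measure (Param d)} [IsProbabilityMeasure P0] {μ : Measure (DataSpace N T Z)} [SFinite μ]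
  {S' : Ω → SuperSample N Z} {U : Ω → Fin N → Fin 2} {V : Ω → Fin T → Finset (Fin N)}
  {ξ : Ω → NoiseSpace d T}

theorem historyLaw_ae_eq (hm : Measurable (Function.uncurry loss))
    (hd : ∀ z, Differentiable ℝ fun w => loss w z) (η σ : Fin T → ℝ)
    (h : HasLaw (fun ω => ((S' ω, U ω, V ω), ξ ω)) (μ.prod (noiseLaw T P0)) P) (t : Fin T) :
    ∀ᵐ ω ∂P, historyLaw P (fun ω => run loss η σ (S' ω, U ω, V ω) (ξ ω)) S' U V t (U ω) (S' ω)
      (V ω) = (noiseLaw T P0).map (history loss η σ t (S' ω, U ω, V ω)) := by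
  let extend (y : (Fin N → Fin 2) × SuperSample N Z × (Set.Iio t → Finset (Fin N))) :
      DataSpace N T Z :=
    (y.2.1, y.1, fun r => if hr : r < t then y.2.2 ⟨r, hr⟩ else ∅)
  refine condDistrib_ae_eq_map_of_factorsThrough h (measurable_history hm hd η σ t)
    (y := fun x => (x.2.1, x.1, fun r : Set.Iio t => x.2.2 r)) (by fun_prop) (k := extend) ?_
    fun x ξ => funext fun r => run_congr η σ fun i hi => ?_
  · refine measurable_snd.fst.prodMk (measurable_fst.prodMk (measurable_pi_lambda _ fun r => ?_))
    by_cases hr : r < t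
    · simp only [hr, dif_pos]
      exact (measurable_pi_apply _).comp measurable_snd.snd
    · simp only [hr, dif_neg, not_false_eq_true]
      exact measurable_const
  · exact dif_pos (Fin.castSucc_lt_castSucc_iff.1 (hi.trans_le r.2))

theorem lintegral_historyLaw_ae_eq (hm : Measurable (Function.uncurry loss))
    (hd : ∀ z, Differentiable ℝ fun w => loss w z) (η σ : Fin T → ℝ)
    {est : Estimator N d T Z} (hest : ∀ t j, Measurable (est t j))
    (h : HasLaw (fun ω => ((S' ω, U ω, V ω), ξ ω)) (μ.prod (noiseLaw T P0)) P) :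
    ∀ᵐ ω ∂P, ∀ j, (∑ t with j ∈ V ω t,
        ∫⁻ h, ENNReal.ofReal (minTerm loss η σ est t j (S' ω) (U ω) (V ω) h)
          ∂(historyLaw P (fun ω => run loss η σ (S' ω, U ω, V ω) (ξ ω)) S' U V t (U ω) (S' ω)
            (V ω))) ^ (1 / 2 : ℝ) = infoBound loss η σ est P0 j (S' ω, U ω, V ω) := by
  filter_upwards [ae_all_iff.2 (historyLaw_ae_eq hm hd η σ h)] with ω hω j
  refine congrArg (· ^ (1 / 2 : ℝ)) (Finset.sum_congr rfl fun t _ => ?_)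
  rw [hω t, lintegral_map]
  · exact ((measurable_minTerm hm hd η σ hest t j).comp
      (measurable_prodMk_left (x := (S' ω, U ω, V ω)))).ennreal_ofReal
  · exact (measurable_history hm hd η σ t).comp measurable_prodMk_left

end SGLD

/-! ### Averaging over the data -/

theorem ofReal_integral_le_lintegral_ofReal {X : Type*} [MeasurableSpace X] {μ : Measure X}
    (f : X → ℝ) : ENNReal.ofReal (∫ x, f x ∂μ) ≤ ∫⁻ x, ENNReal.ofReal (f x) ∂μ := by
  by_cases hf : Integrable f μ
  · rw [integral_eq_lintegral_pos_part_sub_lintegral_neg_part hf]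
    exact (ENNReal.ofReal_le_ofReal (sub_le_self _ ENNReal.toReal_nonneg)).trans
      ENNReal.ofReal_toReal_le
  · simp [integral_undef hf]

theorem lintegral_uniformOn_univ {ι : Type*} [Fintype ι] [MeasurableSpace ι]
    [MeasurableSingletonClass ι] (f : ι → ℝ≥0∞) :
    ∫⁻ i, f i ∂(uniformOn (Set.univ : Set ι)) = (Fintype.card ι : ℝ≥0∞)⁻¹ * ∑ i, f i := by
  rw [uniformOn, ProbabilityTheory.cond, lintegral_smul_measure, Measure.restrict_univ,
    lintegral_count, tsum_fintype, Measure.count_apply MeasurableSet.univ]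
  simp

theorem integral_uniformOn_univ {ι : Type*} [Fintype ι] [MeasurableSpace ι]
    [MeasurableSingletonClass ι] (f : ι → ℝ) :
    ∫ i, f i ∂(uniformOn (Set.univ : Set ι)) = (Fintype.card ι : ℝ)⁻¹ * ∑ i, f i := by
  rw [uniformOn, ProbabilityTheory.cond, integral_smul_measure, Measure.restrict_univ,
    integral_count, Measure.count_apply MeasurableSet.univ]
  simp

theorem measurePreserving_left_comm {α β γ : Type*} [MeasurableSpace α] [MeasurableSpace β]
    [MeasurableSpace γ] (μ : Measure α) (ν : Measure β) (ρ : Measure γ) [SFinite μ] [SFinite ν]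
    [SFinite ρ] :
    MeasurePreserving (fun p : α × β × γ => (p.2.1, p.1, p.2.2)) (μ.prod (ν.prod ρ))
      (ν.prod (μ.prod ρ)) :=
  (measurePreserving_prodAssoc ν μ ρ).comp
    ((Measure.measurePreserving_swap.prod (.id ρ)).comp (measurePreserving_prodAssoc μ ν ρ).symm)

theorem measurePreserving_update {ι : Type*} [Fintype ι] [DecidableEq ι] {X : ι → Type*}
    [∀ i, MeasurableSpace (X i)] (μ : ∀ i, Measure (X i)) [∀ i, IsProbabilityMeasure (μ i)]
    (k : ι) :
    MeasurePreserving (fun p : (∀ i, X i) × X k => Function.update p.1 k p.2)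
      ((Measure.pi μ).prod (μ k)) (Measure.pi μ) := by
  refine ⟨measurable_update', (Measure.pi_eq fun s hs => ?_).symm⟩
  have hpre : (fun p : (∀ i, X i) × X k => Function.update p.1 k p.2) ⁻¹' Set.univ.pi s =
      Set.univ.pi (Function.update s k Set.univ) ×ˢ s k := by
    ext p
    simp only [Set.mem_preimage, Set.mem_univ_pi, Set.mem_prod]
    rw [Function.forall_update_iff p.1 (p := fun i z => z ∈ s i),
      Function.forall_update_iff s (p := fun i S => p.1 i ∈ S)]
    simp only [Set.mem_univ, true_and, and_comm]
  rw [Measure.map_apply measurable_update' (.univ_pi hs), hpre, Measure.prod_prod, Measure.pi_pi,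
    mul_comm, ← Finset.mul_prod_erase _ _ (Finset.mem_univ k),
    ← Finset.mul_prod_erase (f := fun i => μ i (s i)) _ (Finset.mem_univ k)]
  simp only [Function.update_self, measure_univ, one_mul]
  congr 1
  exact Finset.prod_congr rfl fun i hi => by rw [Function.update_of_ne (Finset.ne_of_mem_erase hi)]

theorem integral_apply_eq_integral_integral {ι : Type*} [Fintype ι] [DecidableEq ι] {Z : Type*}
    [MeasurableSpace Z] {μ : Measure Z} [IsProbabilityMeasure μ] {k : ι} {f : (ι → Z) → Z → ℝ}
    (hf : Integrable (Function.uncurry f) ((Measure.pi fun _ => μ).prod μ))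
    (hfk : ∀ s z, f (Function.update s k z) = f s)
    (hfm : AEStronglyMeasurable (fun s => f s (s k)) (Measure.pi fun _ => μ)) :
    ∫ s, f s (s k) ∂(Measure.pi fun _ => μ) = ∫ s, ∫ z, f s z ∂μ ∂(Measure.pi fun _ => μ) := by
  have hmp := measurePreserving_update (fun _ : ι => μ) k
  rw [← hmp.map_eq] at hfm
  conv_lhs => rw [← hmp.map_eq, integral_map hmp.measurable.aemeasurable hfm]
  simp only [hfk, Function.update_self]
  exact integral_prod _ hf

namespace SGLD

variable {N d T : ℕ} {Z : Type*} {loss : Param d → Z → ℝ}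

theorem run_update (η σ : Fin T → ℝ) (s : SuperSample N Z) (u : Fin N → Fin 2)
    (v : Fin T → Finset (Fin N)) (ξ : NoiseSpace d T) (j : Fin N) (z : Z) :
    run loss η σ (Function.update s (j, 1 - u j) z, u, v) ξ = run loss η σ (s, u, v) ξ := by
  have hflip (c : Fin 2) : c ≠ 1 - c := by decide +revert
  have hdata : dataset (Function.update s (j, 1 - u j) z) u = dataset s u :=
    funext fun i => Function.update_of_ne (fun h => by
      obtain ⟨rfl, hu⟩ := Prod.mk.inj h
      exact hflip _ hu) _ _
  simp only [run, hdata]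

theorem genError_eq [MeasurableSpace Z] [NeZero N] (PZ : Measure Z) (w : Param d) (S : Fin N → Z) :
    genError loss PZ w S = (N : ℝ)⁻¹ * ∑ j, (populationRisk loss PZ w - loss w (S j)) := by
  rw [Finset.sum_sub_distrib, Finset.sum_const, Finset.card_univ, Fintype.card_fin, nsmul_eq_mul,
    mul_sub, inv_mul_cancel_left₀ (NeZero.ne _), genError, empiricalRisk, batchRisk, one_div,
    Finset.card_univ, Fintype.card_fin]

variable [MeasurableSpace Z]

/-- The law of the data. -/
noncomputable abbrev dataLaw (T : ℕ) (PZ : Measure Z) (PV : Measure (Fin T → Finset (Fin N))) :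
    Measure (DataSpace N T Z) :=
  (Measure.pi fun _ => PZ).prod <|
    (Measure.pi fun _ => uniformOn (Set.univ : Set (Fin 2))).prod PV

theorem hasLaw_index_data_noise {Ω : Type*} [MeasurableSpace Ω] {P : Measure Ω}
    {PZ : Measure Z} [SigmaFinite PZ] {PV : Measure (Fin T → Finset (Fin N))}
    [SFinite PV] {P0 : Measure (Param d)} [IsProbabilityMeasure P0]
    {S' : Ω → SuperSample N Z} {U : Ω → Fin N → Fin 2} {J : Ω → Fin N}
    {V : Ω → Fin T → Finset (Fin N)} {θ₀ : Ω → Param d} {ε : Ω → Fin T → Param d}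
    (h : HasLaw (fun ω => (S' ω, U ω, J ω, V ω, θ₀ ω, ε ω)) (jointLaw PZ PV P0) P) :
    HasLaw (fun ω => (J ω, (S' ω, U ω, V ω), (θ₀ ω, ε ω)))
      ((uniformOn Set.univ).prod ((dataLaw T PZ PV).prod (noiseLaw T P0))) P := by
  have hindex := ((measurePreserving_left_comm (Measure.pi fun _ : Fin N × Fin 2 => PZ)
    (uniformOn (Set.univ : Set (Fin N)))
    ((Measure.pi fun _ : Fin N => uniformOn (Set.univ : Set (Fin 2))).prod
      (PV.prod (noiseLaw T P0)))).comp ((MeasurePreserving.id _).prod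
        (measurePreserving_left_comm _ _ _))).comp_hasLaw h
  have hbits := (measurePreserving_prodAssoc
    (Measure.pi fun _ : Fin N => uniformOn (Set.univ : Set (Fin 2))) PV (noiseLaw T P0)).symm
  have hdata := (measurePreserving_prodAssoc (Measure.pi fun _ : Fin N × Fin 2 => PZ)
    ((Measure.pi fun _ : Fin N => uniformOn (Set.univ : Set (Fin 2))).prod PV)
    (noiseLaw T P0)).symm
  exact ((MeasurePreserving.id _).prod
    (hdata.comp ((MeasurePreserving.id _).prod hbits))).comp_hasLaw hindex

theorem measurePreserving_setBit (PZ : Measure Z) [SigmaFinite PZ]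
    (PV : Measure (Fin T → Finset (Fin N))) [SFinite PV] (j : Fin N) :
    MeasurePreserving (fun p : DataSpace N T Z × Fin 2 => setBit j p.2 p.1)
      ((dataLaw T PZ PV).prod (uniformOn Set.univ)) (dataLaw T PZ PV) := by
  have hbits : MeasurePreserving
      (fun p : ((Fin N → Fin 2) × (Fin T → Finset (Fin N))) × Fin 2 =>
        (Function.update p.1.1 j p.2, p.1.2))
      (((Measure.pi fun _ => uniformOn (Set.univ : Set (Fin 2))).prod PV).prod
        (uniformOn Set.univ))
      ((Measure.pi fun _ => uniformOn (Set.univ : Set (Fin 2))).prod PV) :=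
    Measure.measurePreserving_swap.comp
      (((MeasurePreserving.id PV).prod
        (measurePreserving_update (fun _ : Fin N => uniformOn (Set.univ : Set (Fin 2))) j)).comp
      ((measurePreserving_prodAssoc PV _ _).comp
        (Measure.measurePreserving_swap.prod (MeasurePreserving.id _))))
  exact ((MeasurePreserving.id _).prod hbits).comp (measurePreserving_prodAssoc _ _ _)

theorem lintegral_setBit (PZ : Measure Z) [SigmaFinite PZ]
    (PV : Measure (Fin T → Finset (Fin N))) [SFinite PV] (j : Fin N)
    {f : DataSpace N T Z → ℝ≥0∞} (hf : Measurable f) :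
    ∫⁻ x, f x ∂(dataLaw T PZ PV) =
      ∫⁻ x, 2⁻¹ * (f (setBit j 0 x) + f (setBit j 1 x)) ∂(dataLaw T PZ PV) := by
  have h := measurePreserving_setBit PZ PV j
  conv_lhs => rw [← h.map_eq, lintegral_map hf h.measurable,
    lintegral_prod (fun p => f (setBit j p.2 p.1)) (hf.comp h.measurable).aemeasurable]
  simp only [lintegral_uniformOn_univ, Fintype.card_fin, Fin.sum_univ_two, Nat.cast_ofNat]

theorem integral_setBit (PZ : Measure Z) [SigmaFinite PZ]
    (PV : Measure (Fin T → Finset (Fin N))) [SFinite PV] (j : Fin N)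
    {f : DataSpace N T Z → ℝ} (hf : Integrable f (dataLaw T PZ PV)) :
    ∫ x, f x ∂(dataLaw T PZ PV) =
      ∫ x, 2⁻¹ * (f (setBit j 0 x) + f (setBit j 1 x)) ∂(dataLaw T PZ PV) := by
  have h := measurePreserving_setBit PZ PV j
  conv_lhs => rw [← h.map_eq, integral_map h.measurable.aemeasurable
    (h.map_eq.symm ▸ hf.aestronglyMeasurable), integral_prod (fun p => f (setBit j p.2 p.1))
    (h.integrable_comp_of_integrable hf)]
  simp only [integral_uniformOn_univ, Fintype.card_fin, Fin.sum_univ_two, Nat.cast_ofNat]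

variable (PZ : Measure Z) [IsProbabilityMeasure PZ] (PV : Measure (Fin T → Finset (Fin N)))
  [IsProbabilityMeasure PV] (P0 : Measure (Param d)) [IsProbabilityMeasure P0] {a b : ℝ}
  (hm : Measurable (Function.uncurry loss)) (hd : ∀ z, Differentiable ℝ fun w => loss w z)
  (hab : ∀ w z, loss w z ∈ Set.Icc a b) (η : Fin T → ℝ) {σ : Fin T → ℝ} {est : Estimator N d T Z}
  (hest : ∀ t j, Measurable (est t j)) (hest' : ∀ t j x, est t j x ∈ Set.Icc (0 : ℝ) 1) (j : Fin N)
include hm hd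

variable (σ) in
include hest in
theorem measurable_infoBound : Measurable (infoBound loss η σ est P0 j) := by
  unfold infoBound
  simp only [Finset.sum_filter]
  refine Measurable.pow_const (Finset.measurable_fun_sum _ fun t _ => Measurable.ite ?_ ?_
    measurable_const) _
  · have hbatch : Measurable fun x : DataSpace N T Z => x.2.2 t := by fun_prop
    exact hbatch (Set.toFinite {B : Finset (Fin N) | j ∈ B}).measurableSet
  · exact Measurable.lintegral_prod_right ((measurable_minTerm hm hd η σ hest t j).comp
      (measurable_fst.prodMk (measurable_history hm hd η σ t))).ennreal_ofReal

include hab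

variable (σ) in
theorem integrable_loss_run (c : Fin 2 → Fin 2) :
    Integrable (fun p : DataSpace N T Z × NoiseSpace d T =>
      loss (run loss η σ p.1 p.2 (Fin.last T)) (p.1.1 (j, c (p.1.2.1 j))))
      ((dataLaw T PZ PV).prod (noiseLaw T P0)) := by
  have hrun := (measurable_pi_apply (Fin.last T)).comp (measurable_run (N := N) hm hd η σ)
  have hpoint : Measurable fun p : DataSpace N T Z × NoiseSpace d T => p.1.1 (j, c (p.1.2.1 j)) :=
    measurable_of_discrete fun u v => (measurable_pi_apply (j, c (u j))).comp measurable_fst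
  exact .of_mem_Icc a b (hm.comp (hrun.prodMk hpoint)).aemeasurable (.of_forall fun _ => hab _ _)

variable (σ) in
theorem integrable_populationRisk_run :
    Integrable (fun p : DataSpace N T Z × NoiseSpace d T =>
      populationRisk loss PZ (run loss η σ p.1 p.2 (Fin.last T)))
      ((dataLaw T PZ PV).prod (noiseLaw T P0)) := by
  have hmeas : Measurable (populationRisk loss PZ) :=
    (hm.stronglyMeasurable.integral_prod_right (ν := PZ)).measurable
  refine .of_mem_Icc a b (hmeas.comp ((measurable_pi_apply (Fin.last T)).comp
    (measurable_run hm hd η σ))).aemeasurable (.of_forall fun p => ?_)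
  exact (convex_Icc a b).integral_mem isClosed_Icc (.of_forall (hab _))
    (.of_mem_Icc a b hm.of_uncurry_left.aemeasurable (.of_forall (hab _)))

variable (σ) in
theorem integral_loss_run_ghost :
    ∫ p, loss (run loss η σ p.1 p.2 (Fin.last T)) (p.1.1 (j, 1 - p.1.2.1 j))
      ∂((dataLaw T PZ PV).prod (noiseLaw T P0)) =
    ∫ p, populationRisk loss PZ (run loss η σ p.1 p.2 (Fin.last T))
      ∂((dataLaw T PZ PV).prod (noiseLaw T P0)) := by
  have hloss := integrable_loss_run PZ PV P0 hm hd hab η σ j (1 - ·)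
  have hrisk := integrable_populationRisk_run PZ PV P0 hm hd hab η σ
  rw [integral_prod_symm _ hloss, integral_prod_symm _ hrisk]
  refine integral_congr_ae ?_
  filter_upwards [hloss.prod_left_ae, hrisk.prod_left_ae] with ξ hloss hrisk
  refine (integral_prod_symm _ hloss).trans (Eq.trans ?_ (integral_prod_symm _ hrisk).symm)
  refine integral_congr_ae (.of_forall fun y => ?_)
  have hrun : Measurable fun s : SuperSample N Z => run loss η σ (s, y) ξ (Fin.last T) :=
    (measurable_pi_apply _).comp ((measurable_run hm hd η σ).comp
      ((measurable_id.prodMk measurable_const).prodMk measurable_const))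
  refine integral_apply_eq_integral_integral (k := (j, 1 - y.1 j))
    (f := fun s => loss (run loss η σ (s, y) ξ (Fin.last T))) ?_ (fun s z => ?_) ?_
  · exact .of_mem_Icc a b (hm.comp ((hrun.comp measurable_fst).prodMk measurable_snd)).aemeasurable
      (.of_forall fun _ => hab _ _)
  · rw [← run_update η σ s y.1 y.2 ξ j z]
  · exact (hm.comp (hrun.prodMk (measurable_pi_apply _))).aestronglyMeasurable

theorem integrable_meanGap : Integrable (meanGap loss η σ P0 j) (dataLaw T PZ PV) :=
  ((integrable_loss_run PZ PV P0 hm hd hab η σ j (1 - ·)).sub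
    (integrable_loss_run PZ PV P0 hm hd hab η σ j fun u => u)).integral_prod_left

variable (σ) in
theorem integrable_populationRisk_sub_loss_run :
    Integrable (fun p : DataSpace N T Z × NoiseSpace d T =>
      populationRisk loss PZ (run loss η σ p.1 p.2 (Fin.last T)) -
        loss (run loss η σ p.1 p.2 (Fin.last T)) (dataset p.1.1 p.1.2.1 j))
      ((dataLaw T PZ PV).prod (noiseLaw T P0)) :=
  (integrable_populationRisk_run PZ PV P0 hm hd hab η σ).sub
    (integrable_loss_run PZ PV P0 hm hd hab η σ j fun u => u)

theorem integral_populationRisk_sub_loss_run :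
    ∫ p, (populationRisk loss PZ (run loss η σ p.1 p.2 (Fin.last T)) -
        loss (run loss η σ p.1 p.2 (Fin.last T)) (dataset p.1.1 p.1.2.1 j))
      ∂((dataLaw T PZ PV).prod (noiseLaw T P0)) =
    ∫ x, meanGap loss η σ P0 j x ∂(dataLaw T PZ PV) := by
  have hghost := integrable_loss_run PZ PV P0 hm hd hab η σ j (1 - ·)
  have hloss := integrable_loss_run PZ PV P0 hm hd hab η σ j fun u => u
  simp only [dataset]
  rw [integral_sub (integrable_populationRisk_run PZ PV P0 hm hd hab η σ) hloss,
    ← integral_loss_run_ghost PZ PV P0 hm hd hab η σ j, ← integral_sub hghost hloss]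
  exact integral_prod _ (hghost.sub hloss)

theorem integrable_genError_run [NeZero N] :
    Integrable (fun p : DataSpace N T Z × NoiseSpace d T =>
      genError loss PZ (run loss η σ p.1 p.2 (Fin.last T)) (dataset p.1.1 p.1.2.1))
      ((dataLaw T PZ PV).prod (noiseLaw T P0)) := by
  simp only [genError_eq]
  exact (integrable_finsetSum _ fun j _ =>
    integrable_populationRisk_sub_loss_run PZ PV P0 hm hd hab η σ j).const_mul _

theorem integral_genError_run [NeZero N] :
    ∫ p, genError loss PZ (run loss η σ p.1 p.2 (Fin.last T)) (dataset p.1.1 p.1.2.1)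
      ∂((dataLaw T PZ PV).prod (noiseLaw T P0)) =
    (N : ℝ)⁻¹ * ∑ j, ∫ x, meanGap loss η σ P0 j x ∂(dataLaw T PZ PV) := by
  simp only [genError_eq]
  rw [integral_const_mul, integral_finsetSum _ fun j _ =>
    integrable_populationRisk_sub_loss_run PZ PV P0 hm hd hab η σ j]
  exact congrArg _ (Finset.sum_congr rfl fun j _ =>
    integral_populationRisk_sub_loss_run PZ PV P0 hm hd hab η j)

include hest hest'

theorem ofReal_integral_meanGap_le (hσ : ∀ t, σ t ≠ 0) :
    ENNReal.ofReal (∫ x, meanGap loss η σ P0 j x ∂(dataLaw T PZ PV)) ≤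
      ENNReal.ofReal (√2 * (b - a)) * ∫⁻ x, infoBound loss η σ est P0 j x ∂(dataLaw T PZ PV) := by
  rw [integral_setBit PZ PV j (integrable_meanGap PZ PV P0 hm hd hab η j),
    lintegral_setBit PZ PV j (measurable_infoBound P0 hm hd η σ hest j),
    ← lintegral_const_mul' _ _ ENNReal.ofReal_ne_top]
  refine (ofReal_integral_le_lintegral_ofReal _).trans (lintegral_mono fun x => ?_)
  rw [ENNReal.ofReal_mul (by positivity), ENNReal.ofReal_inv_of_pos two_pos, ENNReal.ofReal_ofNat,
    mul_left_comm]
  gcongr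
  exact ofReal_meanGap_add_le hm hd η hest hest' j x hab hσ P0

theorem ofReal_integral_genError_run_le [NeZero N] (hσ : ∀ t, σ t ≠ 0) :
    ENNReal.ofReal (∫ p, genError loss PZ (run loss η σ p.1 p.2 (Fin.last T))
      (dataset p.1.1 p.1.2.1) ∂((dataLaw T PZ PV).prod (noiseLaw T P0))) ≤
    ENNReal.ofReal (√2 * (b - a)) * ∫⁻ p, infoBound loss η σ est P0 p.1 p.2
      ∂((uniformOn Set.univ).prod (dataLaw T PZ PV)) := by
  have hN : (0 : ℝ) < N := Nat.cast_pos.2 (NeZero.pos N)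
  rw [integral_genError_run PZ PV P0 hm hd hab η, lintegral_prod _
    (measurable_from_prod_countable_right fun j =>
      measurable_infoBound P0 hm hd η σ hest j).aemeasurable, lintegral_uniformOn_univ,
    Fintype.card_fin, ENNReal.ofReal_mul (by positivity), ENNReal.ofReal_inv_of_pos hN,
    ENNReal.ofReal_natCast, mul_left_comm, Finset.mul_sum]
  gcongr
  refine (Finset.le_sum_of_subadditive ENNReal.ofReal ENNReal.ofReal_zero.le
    (fun _ _ => ENNReal.ofReal_add_le) _ _).trans (Finset.sum_le_sum fun j _ => ?_)
  exact ofReal_integral_meanGap_le PZ PV P0 hm hd hab η hest hest' j hσ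

end SGLD

theorem corollary2 {Ω Z : Type*} [MeasurableSpace Ω] [MeasurableSpace Z] {N d T : ℕ}
    (P : Measure Ω) [IsProbabilityMeasure P]
    (PZ : Measure Z) [IsProbabilityMeasure PZ]
    (PV : Measure (Fin T → Finset (Fin N))) [IsProbabilityMeasure PV]
    (P0 : Measure (SGLD.Param d)) [IsProbabilityMeasure P0]
    (loss : SGLD.Param d → Z → ℝ) (a b : ℝ)
    (hloss_meas : Measurable (Function.uncurry loss))
    (hloss_diff : ∀ z, Differentiable ℝ (fun w => loss w z))
    (hloss_bdd : ∀ w z, loss w z ∈ Set.Icc a b)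
    (η σ : Fin T → ℝ) (hσ : ∀ t, 0 < σ t)
    (S' : Ω → SGLD.SuperSample N Z) (U : Ω → Fin N → Fin 2) (J : Ω → Fin N)
    (V : Ω → Fin T → Finset (Fin N)) (θ₀ : Ω → SGLD.Param d) (ε : Ω → Fin T → SGLD.Param d)
    (hlaw : HasLaw (fun ω => (S' ω, U ω, J ω, V ω, θ₀ ω, ε ω)) (SGLD.jointLaw PZ PV P0) P)
    (S : Ω → Fin N → Z) (hS : S = fun ω => SGLD.dataset (S' ω) (U ω))
    (W : Ω → Fin (T + 1) → SGLD.Param d)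
    (hW : W = fun ω => SGLD.iterates loss η σ (S ω) (V ω) (θ₀ ω) (ε ω))
    (est : SGLD.Estimator N d T Z)
    (hest_meas : ∀ t j, Measurable (est t j))
    (hest_mem : ∀ t j x, est t j x ∈ Set.Icc (0 : ℝ) 1) :
    Integrable (fun ω => SGLD.genError loss PZ (W ω (Fin.last T)) (S ω)) P ∧
    ENNReal.ofReal (∫ ω, SGLD.genError loss PZ (W ω (Fin.last T)) (S ω) ∂P) ≤
      ENNReal.ofReal (√2 * (b - a)) *
        ∫⁻ ω, (∑ t with J ω ∈ V ω t,
          ∫⁻ h, ENNReal.ofReal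
            (SGLD.minTerm loss η σ est t (J ω) (S' ω) (U ω) (V ω) h)
            ∂(SGLD.historyLaw P W S' U V t (U ω) (S' ω) (V ω))) ^ (1 / 2 : ℝ) ∂P := by
  subst hS hW
  obtain ⟨ω₀⟩ := nonempty_of_isProbabilityMeasure P
  have : NeZero N := ⟨(J ω₀).pos.ne'⟩
  have hall := SGLD.hasLaw_index_data_noise hlaw
  have hdata : HasLaw (fun ω => ((S' ω, U ω, V ω), (θ₀ ω, ε ω)))
      ((SGLD.dataLaw T PZ PV).prod (SGLD.noiseLaw T P0)) P :=
    measurePreserving_snd.fun_comp_hasLaw hall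
  have hindex : HasLaw (fun ω => (J ω, (S' ω, U ω, V ω)))
      ((uniformOn Set.univ).prod (SGLD.dataLaw T PZ PV)) P :=
    ((MeasurePreserving.id _).prod measurePreserving_fst).fun_comp_hasLaw hall
  have hgen := SGLD.integrable_genError_run PZ PV P0 hloss_meas hloss_diff hloss_bdd η (σ := σ)
  have hbound : Measurable fun p : Fin N × SGLD.DataSpace N T Z =>
      SGLD.infoBound loss η σ est P0 p.1 p.2 :=
    measurable_from_prod_countable_right
      (SGLD.measurable_infoBound P0 hloss_meas hloss_diff η σ hest_meas)
  refine ⟨(hdata.map_eq.symm ▸ hgen).comp_aemeasurable hdata.aemeasurable, ?_⟩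
  calc ENNReal.ofReal _ = _ := congrArg _ (hdata.integral_comp hgen.aestronglyMeasurable)
    _ ≤ _ := SGLD.ofReal_integral_genError_run_le PZ PV P0 hloss_meas hloss_diff hloss_bdd η
      hest_meas hest_mem fun t => (hσ t).ne'
    _ = _ := congrArg _ (hindex.lintegral_comp hbound.aemeasurable).symm
    _ = _ := congrArg _ <| lintegral_congr_ae ?_
  filter_upwards [SGLD.lintegral_historyLaw_ae_eq hloss_meas hloss_diff η σ hest_meas hdata]
    with ω hω
  exact (hω (J ω)).symm
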